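/- Let $n\ge 1$, let $a_1,\dots,a_m\in\mathbb R^n$, $b_1,\dots,b_m\in\mathbb R$, and let $P=\{x\in\mathbb R^n : a_i\cdot x\le b_i,\ 1\le i\le m\}$ be an $n$-dimensional polytope, i.e. $P$ is bounded and its affine hull is $\mathbb R^n$. Then $P$ is described by the following $2n-1$ explicitly constructed polynomials. The faces of $P$ are the empty set (of dimension $-1$), the nonempty intersections of $P$ with supporting hyperplanes, and $P$. For a face $F\neq P$ let $I_F=\{i : a_i\cdot x=b_i \text{ for all } x\in F\}$ (so $I_\emptyset=\{1,\dots,m\}$) and $$\mathfrak p_F(x)=\sum_{i\in I_F}(b_i-a_i\cdot x),\qquad \mathfrak p_{F,\delta,K}(x)=\big((1+\delta)\,\mathfrak p_F(x)\big)^{2K}-\frac1{|I_F|}\sum_{i\in I_F}\big(2(b_i-a_i\cdot x)-\mathfrak p_F(x)\big)^{2K}.$$ Let $S$ be the largest and $s$ the smallest positive one among the numbers $b_i-a_i\cdot v$, where $1\le i\le m$ and $v$ is a vertex of $P$. Put $\tau=s^2/(32m^3S^2)$ and, for $0\le r\le n-2$, $\delta_r=\tau^{\,n-1-r}$, $K_r=\lceil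 m/\delta_r\rceil$. Let $$\mathfrak P_{r,1}=\prod_{\dim F=r-1}\mathfrak p_F\quad(1\le r\le n),\qquad \mathfrak P_{r,2}=\prod_{\dim F=r-1}\mathfrak p_{F,\delta_r,K_r}\quad(0\le r\le n-2),$$ the products being over the faces $F$ of $P$ of dimension $r-1$. These are $n+(n-1)=2n-1$ polynomials, and $$P=\{x\in\mathbb R^n : \mathfrak P_{r,1}(x)\ge 0\ (1\le r\le n),\ \ \mathfrak P_{r,2}(x)\ge 0\ (0\le r\le n-2)\}.$$ -/

import Mathlib

open MvPolynomial

noncomputable section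

/-- The polyhedron `{x ∈ ℝⁿ : aᵢ · x ≤ bᵢ, 1 ≤ i ≤ m}`. -/
def polyhedron {n m : ℕ} (a : Fin m → Fin n → ℝ) (b : Fin m → ℝ) : Set (Fin n → ℝ) :=
  {x | ∀ i, a i ⬝ᵥ x ≤ b i}

/-- A nonempty subset of `ℝⁿ` whose affine hull has dimension `k`. -/
def HasDim {n : ℕ} (S : Set (Fin n → ℝ)) (k : ℕ) : Prop :=
  S.Nonempty ∧ Module.finrank ℝ (vectorSpan ℝ S) = k

/-- The basic closed semi-algebraic set `{x ∈ ℝⁿ : p₁(x) ≥ 0, …, p_l(x) ≥ 0}`. -/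
def basicClosed {n l : ℕ} (p : Fin l → MvPolynomial (Fin n) ℝ) : Set (Fin n → ℝ) :=
  {x | ∀ j, 0 ≤ eval x (p j)}

/-- The faces of `P` of dimension `r - 1`; the empty set is the face of dimension `-1`, the
other faces are the nonempty intersections of `P` with supporting hyperplanes (and `P` itself).
The faces of rank `r` correspond to the `r`-dimensional faces of the cone
`{(t x, t) : x ∈ P, t ≥ 0}`. -/
def facesOfRank {n : ℕ} (P : Set (Fin n → ℝ)) : ℕ → Set (Set (Fin n → ℝ))
  | 0 => {∅}
  | k + 1 => {F | IsExposed ℝ P F ∧ HasDim F k}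

open Classical in
/-- The set `I_F` of the constraints that are active on all of `F`. For the empty face these are
all the constraints. -/
def activeSet {n m : ℕ} (a : Fin m → Fin n → ℝ) (b : Fin m → ℝ) (F : Set (Fin n → ℝ)) :
    Finset (Fin m) :=
  Finset.univ.filter fun i => ∀ x ∈ F, a i ⬝ᵥ x = b i

/-- A polyhedron has finitely many faces of each rank, so that the products over them below are
honest finite products. -/
theorem facesOfRank_polyhedron_finite {n m : ℕ} (a : Fin m → Fin n → ℝ) (b : Fin m → ℝ) (r : ℕ) :
    (facesOfRank (polyhedron a b) r).Finite := by
  cases r with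
  | zero => exact Set.finite_singleton _
  | succ k =>
    refine Set.Finite.of_finite_image (f := activeSet a b) (Set.toFinite _) ?_
    suffices h : ∀ F G : Set (Fin n → ℝ), F ∈ facesOfRank (polyhedron a b) (k + 1) →
        G ∈ facesOfRank (polyhedron a b) (k + 1) → activeSet a b F = activeSet a b G →
        G ⊆ F from
      fun F hF G hG e => Set.Subset.antisymm (h G F hG hF e.symm) (h F G hF hG e)
    intro F G hF hG e y hy
    obtain ⟨hFe, hFn, -⟩ := hF
    have hyP : y ∈ polyhedron a b := hG.1.subset hy
    have hlin : ∀ (i : Fin m) (s t : ℝ) (u v : Fin n → ℝ),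
        a i ⬝ᵥ (s • u + t • v) = s * (a i ⬝ᵥ u) + t * (a i ⬝ᵥ v) := by
      intro i s t u v
      simp [dotProduct_add, dotProduct_smul]
    have hP : Convex ℝ (polyhedron a b) := by
      intro u hu v hv s t hs ht hst i
      rw [hlin]
      have h1 := mul_le_mul_of_nonneg_left (hu i) hs
      have h2 := mul_le_mul_of_nonneg_left (hv i) ht
      have h3 : s * b i + t * b i = b i := by rw [← add_mul, hst, one_mul]
      linarith
    have hconv : Convex ℝ F := hFe.convex hP
    have hx : ∀ s : Finset (Fin m), (∀ i ∈ s, i ∉ activeSet a b F) →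
        ∃ x ∈ F, ∀ i ∈ s, a i ⬝ᵥ x < b i := by
      intro s
      induction s using Finset.induction_on with
      | empty => exact fun _ => ⟨hFn.some, hFn.some_mem, by simp⟩
      | insert j s _ ih =>
        intro hs
        obtain ⟨x, hx, hxs⟩ := ih fun i hi => hs i (Finset.mem_insert_of_mem hi)
        have hj := hs j (Finset.mem_insert_self j s)
        simp only [activeSet, Finset.mem_filter, Finset.mem_univ, true_and, not_forall] at hj
        obtain ⟨z, hz, hzj⟩ := hj
        refine ⟨(1 / 2 : ℝ) • x + (1 / 2 : ℝ) • z,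
          hconv hx hz (by norm_num) (by norm_num) (by norm_num), fun i hi => ?_⟩
        rw [hlin]
        have h1 := hFe.subset hx i
        have h2 := hFe.subset hz i
        rcases Finset.mem_insert.1 hi with rfl | hi
        · have := lt_of_le_of_ne h2 hzj
          linarith
        · have := hxs i hi
          linarith
    obtain ⟨x, hxF, hx⟩ := hx (Finset.univ.filter fun i => i ∉ activeSet a b F) (by simp)
    have hev : ∀ i, ∀ᶠ t : ℝ in nhdsWithin 0 (Set.Ioi 0),
        a i ⬝ᵥ ((1 + t) • x + (-t) • y) ≤ b i := by
      intro i
      by_cases hi : i ∈ activeSet a b F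
      · refine Filter.Eventually.of_forall fun t => ?_
        have hi' := hi
        rw [e] at hi'
        simp only [activeSet, Finset.mem_filter, Finset.mem_univ, true_and] at hi hi'
        rw [hlin, hi x hxF, hi' y hy]
        linarith
      · have hlt := hx i (by simpa using hi)
        have hc : Continuous fun t : ℝ => (1 + t) * (a i ⬝ᵥ x) + (-t) * (a i ⬝ᵥ y) := by fun_prop
        have := (hc.tendsto 0).eventually_lt_const (u := b i) (by simpa using hlt)
        filter_upwards [nhdsWithin_le_nhds this] with t ht
        rw [hlin]
        exact ht.le
    obtain ⟨t, ht, ht0⟩ := ((Filter.eventually_all.2 hev).and self_mem_nhdsWithin).exists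
    obtain ⟨l, rfl⟩ := hFe ⟨x, hxF⟩
    refine ⟨hyP, fun w hw => (hxF.2 w hw).trans ?_⟩
    have h1 := hxF.2 _ ht
    simp only [map_add, map_smul, smul_eq_mul] at h1
    have ht0' : 0 < t := ht0
    nlinarith

/-- The polynomial `bᵢ - aᵢ · x`. -/
def slackPoly {n m : ℕ} (a : Fin m → Fin n → ℝ) (b : Fin m → ℝ) (i : Fin m) :
    MvPolynomial (Fin n) ℝ :=
  C (b i) - ∑ j, C (a i j) * X j

/-- The polynomial `p_F(x) = ∑_{i ∈ I_F} (bᵢ - aᵢ · x)`. It is nonnegative on `P`; if `P` is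
full-dimensional and `F` is a nonempty face other than `P`, then its zero set is a supporting
hyperplane with `F = P ∩ {p_F = 0}`. -/
def linPoly {n m : ℕ} (a : Fin m → Fin n → ℝ) (b : Fin m → ℝ) (F : Set (Fin n → ℝ)) :
    MvPolynomial (Fin n) ℝ :=
  ∑ i ∈ activeSet a b F, slackPoly a b i

/-- The polynomial
`p_{F,δ,K}(x) = ((1+δ) p_F(x))^{2K} - |I_F|⁻¹ ∑_{i ∈ I_F} (2 (bᵢ - aᵢ · x) - p_F(x))^{2K}`. -/
def powPoly {n m : ℕ} (a : Fin m → Fin n → ℝ) (b : Fin m → ℝ) (δ : ℝ) (K : ℕ)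
    (F : Set (Fin n → ℝ)) : MvPolynomial (Fin n) ℝ :=
  (C (1 + δ) * linPoly a b F) ^ (2 * K) -
    C (((activeSet a b F).card : ℝ)⁻¹) *
      ∑ i ∈ activeSet a b F, (2 * slackPoly a b i - linPoly a b F) ^ (2 * K)

/-- The numbers `bᵢ - aᵢ · v`, where `1 ≤ i ≤ m` and `v` is a vertex of the polyhedron. -/
def vertexSlacks {n m : ℕ} (a : Fin m → Fin n → ℝ) (b : Fin m → ℝ) : Set ℝ :=
  {r | ∃ i, ∃ v ∈ (polyhedron a b).extremePoints ℝ, r = b i - a i ⬝ᵥ v}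

/-- The largest slack of a constraint at a vertex. -/
def maxSlack {n m : ℕ} (a : Fin m → Fin n → ℝ) (b : Fin m → ℝ) : ℝ :=
  sSup (vertexSlacks a b)

/-- The smallest positive slack of a constraint at a vertex. -/
def minSlack {n m : ℕ} (a : Fin m → Fin n → ℝ) (b : Fin m → ℝ) : ℝ :=
  sInf {r ∈ vertexSlacks a b | 0 < r}

/-- The number `τ = s² / (32 m³ S²)`, where `s` is the smallest positive and `S` the largest slack
of a constraint at a vertex. -/
def tau {n m : ℕ} (a : Fin m → Fin n → ℝ) (b : Fin m → ℝ) : ℝ :=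
  minSlack a b ^ 2 / (32 * (m : ℝ) ^ 3 * maxSlack a b ^ 2)

/-- The parameter `δ_r = τ^{n-1-r}`, used for `0 ≤ r ≤ n - 2`. -/
def delta {n m : ℕ} (a : Fin m → Fin n → ℝ) (b : Fin m → ℝ) (r : ℕ) : ℝ :=
  tau a b ^ (n - 1 - r)

/-- The exponent `K_r = ⌈m / δ_r⌉`. -/
def expo {n m : ℕ} (a : Fin m → Fin n → ℝ) (b : Fin m → ℝ) (r : ℕ) : ℕ :=
  ⌈(m : ℝ) / delta a b r⌉₊

/-- The product of the polynomials `p_F` over the faces `F` of dimension `r - 1`. -/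
def linProduct {n m : ℕ} (a : Fin m → Fin n → ℝ) (b : Fin m → ℝ) (r : ℕ) :
    MvPolynomial (Fin n) ℝ :=
  ∏ᶠ F ∈ facesOfRank (polyhedron a b) r, linPoly a b F

/-- The product of the polynomials `p_{F,δ,K}`, where `δ = δ_r` and `K = K_r`, over the faces `F`
of dimension `r - 1`. -/
def powProduct {n m : ℕ} (a : Fin m → Fin n → ℝ) (b : Fin m → ℝ) (r : ℕ) :
    MvPolynomial (Fin n) ℝ :=
  ∏ᶠ F ∈ facesOfRank (polyhedron a b) r, powPoly a b (delta a b r) (expo a b r) F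

/-- The `2n - 1` polynomials: the `n` products `linProduct a b r` with `1 ≤ r ≤ n`, followed by the
`n - 1` products `powProduct a b r` with `0 ≤ r ≤ n - 2`. -/
def polytopePolys {n m : ℕ} (a : Fin m → Fin n → ℝ) (b : Fin m → ℝ) :
    Fin (2 * n - 1) → MvPolynomial (Fin n) ℝ :=
  fun j => if (j : ℕ) < n then linProduct a b (j + 1) else powProduct a b (j - n)

end

/-! On `P` every active slack lies between 0 and `p_F`, so all factors are nonnegative there.
Conversely, a nonnegative product only fixes the sign of a factor once the other factors are known
to be positive, so the task is to show that at most one face of each rank is critical at `x`.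

For large `K`, nonnegativity of `p_{F,δ,K}` means roughly `|2 slackᵢ - p_F| ≤ (1 + 2δ)|p_F|`; if
also `p_F > 0`, the active constraints are violated by at most `δ p_F` (`NearFace`). For `n ≥ 2` the
empty face is the only face of rank 0, and `nearFace_empty` starts a chain there.

Let `x` be near `F`, of rank `r`. Take the least rank `K` with `r < K ≤ n - 2` that has a face `G`
with `p_G(x) < 4mτ^(K-r) p_F(x)`. A second such face would make the sum of slacks of the meet small
as well (`NearFace.faceSum_cutFace_lt`). The meet contains `F` and has rank below `K`, against
minimality. So `G` is unique, the other factors of rank `K` are positive, and the signs of the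
products pass to `G`: `x` lies in `P` or is near `G` (`NearFace.step`). Ranks increase, so this ends
at a face for which no such `K` exists.

Then suppose `x ∉ P`. A facet inequality is violated, and the product over the facets gives a second
facet with nonpositive sum. They meet in a ridge, whose sum is negative (`faceSum_ridge_neg`). The
product over the ridges gives a second ridge with nonpositive sum, against uniqueness. The case `n =
1` needs only the two end points of an interval. -/

/-- The slack `bᵢ - aᵢ · x` of the `i`-th constraint at `x`. -/
def slack {n m : ℕ} (a : Fin m → Fin n → ℝ) (b : Fin m → ℝ) (i : Fin m) (x : Fin n → ℝ) : ℝ :=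
  b i - a i ⬝ᵥ x

/-- The sum of the slacks of the constraints that are active on `F`. -/
noncomputable def faceSum {n m : ℕ} (a : Fin m → Fin n → ℝ) (b : Fin m → ℝ)
    (F : Set (Fin n → ℝ)) (x : Fin n → ℝ) : ℝ :=
  ∑ i ∈ activeSet a b F, slack a b i x

/-- The points of the polyhedron at which all constraints in `J` are active. -/
def cutFace {n m : ℕ} (a : Fin m → Fin n → ℝ) (b : Fin m → ℝ) (J : Finset (Fin m)) :
    Set (Fin n → ℝ) :=
  {x ∈ polyhedron a b | ∀ i ∈ J, slack a b i x = 0}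

/-! ### Slacks, faces and the monotonicity of the rank. -/

section Basic

variable {n m : ℕ} {a : Fin m → Fin n → ℝ} {b : Fin m → ℝ}

theorem mem_polyhedron_iff {x : Fin n → ℝ} : x ∈ polyhedron a b ↔ ∀ i, 0 ≤ slack a b i x := by
  simp [polyhedron, slack]

theorem mem_activeSet {F : Set (Fin n → ℝ)} {i : Fin m} :
    i ∈ activeSet a b F ↔ ∀ x ∈ F, slack a b i x = 0 := by
  simp only [activeSet, Finset.mem_filter, Finset.mem_univ, true_and, slack, sub_eq_zero]
  exact forall₂_congr fun _ _ => eq_comm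

theorem activeSet_anti {F G : Set (Fin n → ℝ)} (h : F ⊆ G) :
    activeSet a b G ⊆ activeSet a b F :=
  fun _ hi => mem_activeSet.2 fun x hx => mem_activeSet.1 hi x (h hx)

theorem activeSet_empty : activeSet a b (∅ : Set (Fin n → ℝ)) = Finset.univ := by
  ext i; simp [mem_activeSet]

theorem slack_comb (i : Fin m) {s t : ℝ} (h : s + t = 1) (x y : Fin n → ℝ) :
    slack a b i (s • x + t • y) = s * slack a b i x + t * slack a b i y := by
  simp only [slack, dotProduct_add, dotProduct_smul, smul_eq_mul]
  linear_combination (-b i) * h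

theorem slack_line (i : Fin m) (t : ℝ) (x y : Fin n → ℝ) :
    slack a b i (x + t • (y - x)) = slack a b i x + t * (slack a b i y - slack a b i x) := by
  simp only [slack, dotProduct_add, dotProduct_smul, dotProduct_sub, smul_eq_mul]
  ring

theorem faceSum_comb (F : Set (Fin n → ℝ)) {s t : ℝ} (h : s + t = 1) (x y : Fin n → ℝ) :
    faceSum a b F (s • x + t • y) = s * faceSum a b F x + t * faceSum a b F y := by
  simp only [faceSum, slack_comb _ h, Finset.sum_add_distrib, Finset.mul_sum]

@[fun_prop]
theorem continuous_slack (i : Fin m) : Continuous (slack a b i) := by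
  unfold slack dotProduct; fun_prop

theorem eval_slackPoly (i : Fin m) (x : Fin n → ℝ) :
    eval x (slackPoly a b i) = slack a b i x := by
  simp [slackPoly, slack, dotProduct]

theorem eval_linPoly (F : Set (Fin n → ℝ)) (x : Fin n → ℝ) :
    eval x (linPoly a b F) = faceSum a b F x := by
  simp [linPoly, faceSum, eval_slackPoly]

theorem eval_powPoly (δ : ℝ) (K : ℕ) (F : Set (Fin n → ℝ)) (x : Fin n → ℝ) :
    eval x (powPoly a b δ K F) = ((1 + δ) * faceSum a b F x) ^ (2 * K) -
      ((activeSet a b F).card : ℝ)⁻¹ *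
        ∑ i ∈ activeSet a b F, (2 * slack a b i x - faceSum a b F x) ^ (2 * K) := by
  have h2 : eval x (2 : MvPolynomial (Fin n) ℝ) = 2 := map_ofNat _ 2
  simp [powPoly, eval_slackPoly, eval_linPoly, h2]

theorem eval_linProduct (r : ℕ) (x : Fin n → ℝ) :
    eval x (linProduct a b r) =
      ∏ F ∈ (facesOfRank_polyhedron_finite a b r).toFinset, faceSum a b F x := by
  rw [linProduct, finprod_mem_eq_finite_toFinset_prod _ (facesOfRank_polyhedron_finite a b r),
    map_prod]
  simp only [eval_linPoly]

theorem eval_powProduct (r : ℕ) (x : Fin n → ℝ) :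
    eval x (powProduct a b r) = ∏ F ∈ (facesOfRank_polyhedron_finite a b r).toFinset,
      eval x (powPoly a b (delta a b r) (expo a b r) F) := by
  rw [powProduct, finprod_mem_eq_finite_toFinset_prod _ (facesOfRank_polyhedron_finite a b r),
    map_prod]

theorem convex_polyhedron : Convex ℝ (polyhedron a b) := by
  intro x hx y hy s t hs ht hst
  rw [mem_polyhedron_iff] at *
  intro i
  rw [slack_comb i hst]
  have := hx i
  have := hy i
  positivity

theorem isClosed_polyhedron : IsClosed (polyhedron a b) := by
  have : polyhedron a b = ⋂ i, {x | 0 ≤ slack a b i x} := by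
    ext x; simp [mem_polyhedron_iff]
  rw [this]
  exact isClosed_iInter fun i => isClosed_le continuous_const (continuous_slack i)

theorem isCompact_polyhedron (hbdd : Bornology.IsBounded (polyhedron a b)) :
    IsCompact (polyhedron a b) :=
  Metric.isCompact_of_isClosed_isBounded isClosed_polyhedron hbdd

theorem faceSum_nonneg (F : Set (Fin n → ℝ)) {x : Fin n → ℝ} (hx : x ∈ polyhedron a b) :
    0 ≤ faceSum a b F x :=
  Finset.sum_nonneg fun i _ => mem_polyhedron_iff.1 hx i

theorem faceSum_eq_zero {F : Set (Fin n → ℝ)} {x : Fin n → ℝ} (hx : x ∈ F) :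
    faceSum a b F x = 0 :=
  Finset.sum_eq_zero fun _ hi => mem_activeSet.1 hi x hx

/-- If all slacks that vanish at `x ∈ P` vanish at `y`, then `P` contains the segment from `y`
to a point slightly beyond `x`. -/
theorem exists_extend {x y : Fin n → ℝ} (hx : x ∈ polyhedron a b)
    (h : ∀ i, slack a b i x = 0 → slack a b i y = 0) :
    ∃ t : ℝ, 0 < t ∧ x + t • (x - y) ∈ polyhedron a b := by
  have hev : ∀ i, ∀ᶠ t : ℝ in nhdsWithin 0 (Set.Ioi 0), 0 ≤ slack a b i (x + t • (x - y)) := by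
    intro i
    have e : ∀ t : ℝ, slack a b i (x + t • (x - y)) =
        slack a b i x + t * (slack a b i x - slack a b i y) := by
      intro t
      simp only [slack, dotProduct_add, dotProduct_smul, dotProduct_sub, smul_eq_mul]
      ring
    by_cases hi : slack a b i x = 0
    · exact Filter.Eventually.of_forall fun t => by rw [e, hi, h i hi]; simp
    · have hpos := lt_of_le_of_ne (mem_polyhedron_iff.1 hx i) (Ne.symm hi)
      have hc : Continuous fun t : ℝ => slack a b i x + t * (slack a b i x - slack a b i y) := by
        fun_prop
      have := (hc.tendsto 0).eventually_const_lt (u := 0) (by simpa using hpos)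
      filter_upwards [nhdsWithin_le_nhds this] with t ht
      rw [e]
      exact ht.le
  obtain ⟨t, ht, ht0⟩ := ((Filter.eventually_all.2 hev).and self_mem_nhdsWithin).exists
  exact ⟨t, ht0, mem_polyhedron_iff.2 ht⟩

/-- A nonempty convex subset of `P` has a point at which only the constraints active on the
whole subset are active. -/
theorem exists_slack_pos {F : Set (Fin n → ℝ)} (hF : Convex ℝ F) (hne : F.Nonempty)
    (hFP : F ⊆ polyhedron a b) :
    ∃ x ∈ F, ∀ i ∉ activeSet a b F, 0 < slack a b i x := by
  classical
  have key : ∀ s : Finset (Fin m), (∀ i ∈ s, i ∉ activeSet a b F) →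
      ∃ x ∈ F, ∀ i ∈ s, 0 < slack a b i x := by
    intro s
    induction s using Finset.induction_on with
    | empty => exact fun _ => ⟨hne.some, hne.some_mem, by simp⟩
    | insert j s _ ih =>
      intro hs
      obtain ⟨x, hx, hxs⟩ := ih fun i hi => hs i (Finset.mem_insert_of_mem hi)
      have hj := hs j (Finset.mem_insert_self j s)
      rw [mem_activeSet] at hj
      push Not at hj
      obtain ⟨z, hz, hzj⟩ := hj
      refine ⟨(1 / 2 : ℝ) • x + (1 / 2 : ℝ) • z,
        hF hx hz (by norm_num) (by norm_num) (by norm_num), fun i hi => ?_⟩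
      rw [slack_comb i (by norm_num)]
      have h1 := mem_polyhedron_iff.1 (hFP hx) i
      have h2 := mem_polyhedron_iff.1 (hFP hz) i
      rcases Finset.mem_insert.1 hi with rfl | hi
      · have := lt_of_le_of_ne h2 (Ne.symm hzj)
        linarith
      · have := hxs i hi
        linarith
  obtain ⟨x, hxF, hx⟩ := key (Finset.univ.filter fun i => i ∉ activeSet a b F) (by simp)
  exact ⟨x, hxF, fun i hi => hx i (by simpa using hi)⟩

/-- Extend the segment from `y` to a relatively interior point `x` of `F` slightly beyond `x`,
inside `P`. The exposing functional is maximal at `x`, so it cannot be smaller at `y`. -/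
theorem mem_of_isExposed {F : Set (Fin n → ℝ)} (hF : IsExposed ℝ (polyhedron a b) F)
    (hne : F.Nonempty) {y : Fin n → ℝ} (hy : y ∈ polyhedron a b)
    (h : ∀ i ∈ activeSet a b F, slack a b i y = 0) : y ∈ F := by
  obtain ⟨x, hxF, hx⟩ := exists_slack_pos (hF.convex convex_polyhedron) hne hF.subset
  obtain ⟨t, ht0, ht⟩ := exists_extend (y := y) (hF.subset hxF) fun i hi => h i <| by
    by_contra hc
    exact (hx i hc).ne' hi
  obtain ⟨l, rfl⟩ := hF ⟨x, hxF⟩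
  refine ⟨hy, fun w hw => (hxF.2 w hw).trans ?_⟩
  have h1 := hxF.2 _ ht
  simp only [map_add, map_smul, map_sub, smul_eq_mul] at h1
  nlinarith

theorem subset_activeSet_cutFace (J : Finset (Fin m)) : J ⊆ activeSet a b (cutFace a b J) :=
  fun i hi => mem_activeSet.2 fun _ hx => hx.2 i hi

/-- The functional `∑ i ∈ J, a i` exposes it: on `P` it is largest exactly where the slacks in `J`
vanish. -/
theorem isExposed_cutFace (J : Finset (Fin m)) :
    IsExposed ℝ (polyhedron a b) (cutFace a b J) := by
  rintro ⟨x₀, hx₀⟩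
  let l : (Fin n → ℝ) →ₗ[ℝ] ℝ := ∑ i ∈ J, dotProductBilin ℝ ℝ (a i)
  have hl : ∀ x, l x = ∑ i ∈ J, b i - ∑ i ∈ J, slack a b i x := by
    intro x
    simp [l, slack, dotProductBilin]
  refine ⟨LinearMap.toContinuousLinearMap l, ?_⟩
  ext x
  simp only [cutFace, Set.mem_ofPred_eq, LinearMap.coe_toContinuousLinearMap', hl]
  refine and_congr_right fun hx => ⟨fun h y hy => ?_, fun h => ?_⟩
  · rw [Finset.sum_eq_zero h]
    have := Finset.sum_nonneg fun i (_ : i ∈ J) => mem_polyhedron_iff.1 hy i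
    linarith
  · have h1 := h x₀ hx₀.1
    rw [Finset.sum_eq_zero hx₀.2] at h1
    have h2 := Finset.sum_nonneg fun i (_ : i ∈ J) => mem_polyhedron_iff.1 hx i
    exact (Finset.sum_eq_zero_iff_of_nonneg fun i _ => mem_polyhedron_iff.1 hx i).1 (by linarith)

theorem exists_rank_cutFace (J : Finset (Fin m)) :
    ∃ k, cutFace a b J ∈ facesOfRank (polyhedron a b) k := by
  rcases (cutFace a b J).eq_empty_or_nonempty with h | h
  · exact ⟨0, h⟩
  · exact ⟨_ + 1, isExposed_cutFace J, h, rfl⟩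

theorem subset_of_mem_facesOfRank {k : ℕ} {F : Set (Fin n → ℝ)}
    (hF : F ∈ facesOfRank (polyhedron a b) k) : F ⊆ polyhedron a b := by
  cases k with
  | zero => obtain rfl : F = ∅ := hF; exact Set.empty_subset _
  | succ k => exact hF.1.subset

theorem vectorSpan_le_ker {F : Set (Fin n → ℝ)} {i : Fin m} (hi : i ∈ activeSet a b F) :
    vectorSpan ℝ F ≤ LinearMap.ker (dotProductBilin ℝ ℝ (a i)) := by
  rw [vectorSpan_def, Submodule.span_le]
  rintro _ ⟨y, hy, z, hz, rfl⟩
  have h1 := mem_activeSet.1 hi y hy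
  have h2 := mem_activeSet.1 hi z hz
  simp only [slack] at h1 h2
  simp [dotProductBilin, dotProduct_sub]
  linarith

/-- Some constraint active on `F` is positive at a point of `G`, so its linear part kills the
direction space of `F` but not that of `G`. -/
theorem rank_lt_of_ssubset {j k : ℕ} {F G : Set (Fin n → ℝ)}
    (hF : F ∈ facesOfRank (polyhedron a b) j) (hG : G ∈ facesOfRank (polyhedron a b) k)
    (h : F ⊂ G) : j < k := by
  cases k with
  | zero =>
    obtain rfl : G = ∅ := hG
    exact absurd (Set.empty_subset F) h.2
  | succ k =>
  cases j with
  | zero => exact Nat.succ_pos k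
  | succ j =>
    obtain ⟨g, hg, hgF⟩ := Set.exists_of_ssubset h
    have : ∃ i ∈ activeSet a b F, slack a b i g ≠ 0 := by
      by_contra hc
      push Not at hc
      exact hgF (mem_of_isExposed hF.1 hF.2.1 (hG.1.subset hg) hc)
    obtain ⟨i, hi, hig⟩ := this
    obtain ⟨f, hf⟩ := hF.2.1
    rw [← hF.2.2, ← hG.2.2, Nat.succ_lt_succ_iff]
    refine Submodule.finrank_lt_finrank_of_lt
      (lt_of_le_of_ne (vectorSpan_mono ℝ h.subset) fun e => hig ?_)
    have hm : g - f ∈ vectorSpan ℝ F := by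
      rw [e]; exact vsub_mem_vectorSpan ℝ hg (h.subset hf)
    have h1 := vectorSpan_le_ker hi hm
    have h2 := mem_activeSet.1 hi f hf
    simp [dotProductBilin, dotProduct_sub] at h1
    simp only [slack] at h2 ⊢
    linarith

end Basic

/-! ### Vertices and affine inequalities on the polytope. -/

section Vertices

variable {n m : ℕ} {a : Fin m → Fin n → ℝ} {b : Fin m → ℝ}

theorem eq_zero_of_ray_subset (hbdd : Bornology.IsBounded (polyhedron a b)) {x v : Fin n → ℝ}
    (h : ∀ t : ℝ, 0 ≤ t → x + t • v ∈ polyhedron a b) : v = 0 := by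
  by_contra hv
  obtain ⟨R, hR⟩ := hbdd.exists_norm_le
  have hv' : 0 < ‖v‖ := norm_pos_iff.2 hv
  have hR0 : 0 ≤ R := (norm_nonneg _).trans (hR _ (h 0 le_rfl))
  have ht : 0 ≤ (R + ‖x‖ + 1) / ‖v‖ := by positivity
  have h1 := hR _ (h _ ht)
  have h2 : ‖((R + ‖x‖ + 1) / ‖v‖) • v‖ = R + ‖x‖ + 1 := by
    rw [norm_smul, Real.norm_of_nonneg ht, div_mul_cancel₀ _ hv'.ne']
  have h3 := norm_sub_le (x + ((R + ‖x‖ + 1) / ‖v‖) • v) x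
  rw [add_sub_cancel_left, h2] at h3
  linarith

/-- Rows with `a i = 0` and `b i = 0` are not excluded. They are the only constraints active on all
of `P`, and account for the first alternative in `exists_center`. -/
theorem slack_eq_zero_of_hasDim (hdim : HasDim (polyhedron a b) n) {i : Fin m}
    (h : ∀ x ∈ polyhedron a b, slack a b i x = 0) (y : Fin n → ℝ) : slack a b i y = 0 := by
  have htop : vectorSpan ℝ (polyhedron a b) = ⊤ :=
    Submodule.eq_top_of_finrank_eq (by simpa using hdim.2)
  obtain ⟨x, hx⟩ := hdim.1
  have h1 : y - x ∈ LinearMap.ker (dotProductBilin ℝ ℝ (a i)) :=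
    vectorSpan_le_ker (mem_activeSet.2 h) (htop ▸ Submodule.mem_top)
  have h2 := h x hx
  simp [dotProductBilin, dotProduct_sub] at h1
  simp only [slack] at h2 ⊢
  linarith

theorem exists_ne_of_hasDim (hn : 1 ≤ n) (hdim : HasDim (polyhedron a b) n) (x : Fin n → ℝ) :
    ∃ y ∈ polyhedron a b, y ≠ x := by
  by_contra hc
  push Not at hc
  have hs : vectorSpan ℝ (polyhedron a b) ≤ vectorSpan ℝ ({x} : Set (Fin n → ℝ)) :=
    vectorSpan_mono ℝ fun y hy => hc y hy
  rw [vectorSpan_singleton, le_bot_iff] at hs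
  have := hdim.2
  rw [hs, finrank_bot] at this
  omega

/-- Otherwise `P` would be a cone with apex `x`, and a second point of `P` would give an unbounded
ray. -/
theorem exists_slack_pos_of_mem (hn : 1 ≤ n) (hbdd : Bornology.IsBounded (polyhedron a b))
    (hdim : HasDim (polyhedron a b) n) {x : Fin n → ℝ} (hx : x ∈ polyhedron a b) :
    ∃ i, 0 < slack a b i x := by
  by_contra hc
  push Not at hc
  have h0 : ∀ i, slack a b i x = 0 := fun i => le_antisymm (hc i) (mem_polyhedron_iff.1 hx i)
  obtain ⟨y, hy, hne⟩ := exists_ne_of_hasDim hn hdim x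
  refine hne (sub_eq_zero.1 (eq_zero_of_ray_subset hbdd (x := x) fun t ht => ?_))
  refine mem_polyhedron_iff.2 fun i => ?_
  rw [slack_line, h0]
  have := mem_polyhedron_iff.1 hy i
  simp only [sub_zero, zero_add]
  positivity

theorem pos_of_hasDim (hn : 1 ≤ n) (hbdd : Bornology.IsBounded (polyhedron a b))
    (hdim : HasDim (polyhedron a b) n) : 0 < m := by
  obtain ⟨y, hy⟩ := hdim.1
  obtain ⟨i, -⟩ := exists_slack_pos_of_mem hn hbdd hdim hy
  exact i.pos

/-- A vertex is determined by its active set: with equal active sets, the segment from `w` to `v`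
could be prolonged in `P` beyond `v`. -/
theorem finite_extremePoints : ((polyhedron a b).extremePoints ℝ).Finite := by
  refine Set.Finite.of_finite_image (f := fun v => activeSet a b {v}) (Set.toFinite _) ?_
  intro v hv w hw e
  obtain ⟨t, ht0, ht⟩ := exists_extend (y := w) hv.1 fun i hi => by
    have h1 : i ∈ activeSet a b {v} := mem_activeSet.2 (by simpa using hi)
    have e' : activeSet a b {v} = activeSet a b {w} := e
    rw [e'] at h1
    simpa using mem_activeSet.1 h1 w rfl
  have hseg : v ∈ openSegment ℝ w (v + t • (v - w)) := by
    refine ⟨t / (1 + t), 1 / (1 + t), by positivity, by positivity, by field_simp; ring, ?_⟩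
    ext j
    simp only [Pi.add_apply, Pi.smul_apply, Pi.sub_apply, smul_eq_mul]
    field_simp
    ring
  exact (hv.2 hw.1 ht hseg).symm

theorem finite_vertexSlacks : (vertexSlacks a b).Finite := by
  have : vertexSlacks a b =
      ⋃ i, (fun v => b i - a i ⬝ᵥ v) '' (polyhedron a b).extremePoints ℝ := by
    ext r
    simp [vertexSlacks, eq_comm]
  rw [this]
  exact Set.finite_iUnion fun i => finite_extremePoints.image _

theorem slack_le_maxSlack {v : Fin n → ℝ} (hv : v ∈ (polyhedron a b).extremePoints ℝ)
    (i : Fin m) : slack a b i v ≤ maxSlack a b :=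
  le_csSup finite_vertexSlacks.bddAbove ⟨i, v, hv, rfl⟩

theorem minSlack_le_slack {v : Fin n → ℝ} (hv : v ∈ (polyhedron a b).extremePoints ℝ)
    {i : Fin m} (h : 0 < slack a b i v) : minSlack a b ≤ slack a b i v :=
  csInf_le (finite_vertexSlacks.subset fun _ hr => hr.1).bddBelow ⟨⟨i, v, hv, rfl⟩, h⟩

/-- An affine inequality that holds at the vertices holds on the whole polytope. -/
theorem nonneg_of_extremePoints (hbdd : Bornology.IsBounded (polyhedron a b))
    {f : (Fin n → ℝ) → ℝ} (hf : Continuous f)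
    (haff : ∀ (s t : ℝ) (x y : Fin n → ℝ), s + t = 1 → f (s • x + t • y) = s * f x + t * f y)
    (h : ∀ v ∈ (polyhedron a b).extremePoints ℝ, 0 ≤ f v) {x : Fin n → ℝ}
    (hx : x ∈ polyhedron a b) : 0 ≤ f x := by
  have hconv : Convex ℝ {x | 0 ≤ f x} := by
    intro x hx y hy s t hs ht hst
    have hx' : 0 ≤ f x := hx
    have hy' : 0 ≤ f y := hy
    show 0 ≤ f _
    rw [haff s t x y hst]
    positivity
  have hsub : closure (convexHull ℝ ((polyhedron a b).extremePoints ℝ)) ⊆ {x | 0 ≤ f x} :=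
    closure_minimal (convexHull_min h hconv) (isClosed_le continuous_const hf)
  rw [closure_convexHull_extremePoints (isCompact_polyhedron hbdd) convex_polyhedron] at hsub
  exact hsub hx

theorem slack_le_maxSlack_of_mem (hbdd : Bornology.IsBounded (polyhedron a b)) (i : Fin m)
    {x : Fin n → ℝ} (hx : x ∈ polyhedron a b) : slack a b i x ≤ maxSlack a b := by
  have := nonneg_of_extremePoints (f := fun y => maxSlack a b - slack a b i y) hbdd
    (by fun_prop) (fun s t x y hst => by
      simp only [slack_comb i hst]
      linear_combination (-maxSlack a b) * hst)
    (fun v hv => sub_nonneg.2 (slack_le_maxSlack hv i)) hx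
  linarith

theorem exists_extremePoint_slack_pos (hbdd : Bornology.IsBounded (polyhedron a b)) {i : Fin m}
    {x : Fin n → ℝ} (hx : x ∈ polyhedron a b) (hi : 0 < slack a b i x) :
    ∃ v ∈ (polyhedron a b).extremePoints ℝ, 0 < slack a b i v := by
  by_contra hc
  push Not at hc
  have := nonneg_of_extremePoints (f := fun y => - slack a b i y) hbdd
    (by fun_prop) (fun s t x y hst => by
      simp only [slack_comb i hst]
      ring)
    (fun v hv => by linarith [hc v hv]) hx
  linarith

/-- The infimum is over a nonempty finite set, hence attained; the default value of `sInf` does not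
occur. -/
theorem minSlack_pos_le (hn : 1 ≤ n) (hbdd : Bornology.IsBounded (polyhedron a b))
    (hdim : HasDim (polyhedron a b) n) :
    0 < minSlack a b ∧ minSlack a b ≤ maxSlack a b := by
  obtain ⟨x, hx⟩ := hdim.1
  obtain ⟨i, hi⟩ := exists_slack_pos_of_mem hn hbdd hdim hx
  obtain ⟨v, hv, hvi⟩ := exists_extremePoint_slack_pos hbdd hx hi
  have hmem : minSlack a b ∈ {r ∈ vertexSlacks a b | 0 < r} :=
    Set.Nonempty.csInf_mem ⟨_, ⟨i, v, hv, rfl⟩, hvi⟩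
      (finite_vertexSlacks.subset fun _ hr => hr.1)
  exact ⟨hmem.2, (minSlack_le_slack hv hvi).trans (slack_le_maxSlack hv i)⟩

theorem faceSum_le (hbdd : Bornology.IsBounded (polyhedron a b)) (F : Set (Fin n → ℝ))
    {x : Fin n → ℝ} (hx : x ∈ polyhedron a b) : faceSum a b F x ≤ m * maxSlack a b := by
  calc faceSum a b F x ≤ ∑ i, slack a b i x :=
        Finset.sum_le_sum_of_subset_of_nonneg (Finset.subset_univ _)
          fun i _ _ => mem_polyhedron_iff.1 hx i
    _ ≤ ∑ _i : Fin m, maxSlack a b :=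
        Finset.sum_le_sum fun i _ => slack_le_maxSlack_of_mem hbdd i hx
    _ = m * maxSlack a b := by simp

/-- There is a point of `P` at which no constraint is close to being active. -/
theorem exists_center (hbdd : Bornology.IsBounded (polyhedron a b))
    (hdim : HasDim (polyhedron a b) n) (hm : 0 < m) :
    ∃ q ∈ polyhedron a b,
      ∀ i, (∀ y, slack a b i y = 0) ∨ minSlack a b / m ≤ slack a b i q := by
  have hm' : (m : ℝ) ≠ 0 := by positivity
  have hex : ∀ i, ∃ v ∈ (polyhedron a b).extremePoints ℝ,
      (∀ y, slack a b i y = 0) ∨ minSlack a b ≤ slack a b i v := by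
    intro i
    by_cases h : ∀ x ∈ polyhedron a b, slack a b i x = 0
    · obtain ⟨v, hv⟩ := (isCompact_polyhedron hbdd).extremePoints_nonempty hdim.1 (E := Fin n → ℝ)
      exact ⟨v, hv, Or.inl (slack_eq_zero_of_hasDim hdim h)⟩
    · push Not at h
      obtain ⟨x, hx, hxi⟩ := h
      obtain ⟨v, hv, hvi⟩ := exists_extremePoint_slack_pos hbdd hx
        (lt_of_le_of_ne (mem_polyhedron_iff.1 hx i) hxi.symm)
      exact ⟨v, hv, Or.inr (minSlack_le_slack hv hvi)⟩
  choose v hv hvi using hex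
  -- The centre is the mean of `m` vertices, one for each constraint.
  have hslack : ∀ i, slack a b i (∑ j, (m : ℝ)⁻¹ • v j) = (m : ℝ)⁻¹ * ∑ j, slack a b i (v j) := by
    intro i
    simp only [slack, dotProduct_sum, dotProduct_smul, smul_eq_mul, Finset.sum_sub_distrib,
      Finset.sum_const, Finset.card_univ, Fintype.card_fin, nsmul_eq_mul, Finset.mul_sum, mul_sub]
    field_simp
  have hnn : ∀ i j, 0 ≤ slack a b i (v j) := fun i j => mem_polyhedron_iff.1 (hv j).1 i
  refine ⟨∑ j, (m : ℝ)⁻¹ • v j, mem_polyhedron_iff.2 fun i => ?_, fun i => ?_⟩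
  · rw [hslack]
    exact mul_nonneg (by positivity) (Finset.sum_nonneg fun j _ => hnn i j)
  · refine (hvi i).imp_right fun h => ?_
    rw [hslack, div_eq_inv_mul]
    refine mul_le_mul_of_nonneg_left (h.trans ?_) (by positivity)
    exact Finset.single_le_sum (f := fun j => slack a b i (v j)) (fun j _ => hnn i j)
      (Finset.mem_univ i)

/-- A sum of slacks controls the sum of the slacks that it forces to be active. -/
theorem faceSum_cutFace_le (hn : 1 ≤ n) (hbdd : Bornology.IsBounded (polyhedron a b))
    (hdim : HasDim (polyhedron a b) n) (J : Finset (Fin m)) {x : Fin n → ℝ}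
    (hx : x ∈ polyhedron a b) :
    minSlack a b * faceSum a b (cutFace a b J) x ≤
      m * maxSlack a b * ∑ i ∈ J, slack a b i x := by
  obtain ⟨hs, hsS⟩ := minSlack_pos_le hn hbdd hdim
  have hS : 0 < maxSlack a b := hs.trans_le hsS
  have := nonneg_of_extremePoints (f := fun y => m * maxSlack a b * ∑ i ∈ J, slack a b i y -
      minSlack a b * faceSum a b (cutFace a b J) y) hbdd
    (by unfold faceSum; fun_prop) (fun s t x y hst => by
      simp only [slack_comb _ hst, faceSum_comb _ hst, Finset.sum_add_distrib, ← Finset.mul_sum]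
      ring)
    (fun v hv => ?_) hx
  · linarith
  · have hnn := fun i (_ : i ∈ J) => mem_polyhedron_iff.1 hv.1 i
    by_cases hJ : ∀ i ∈ J, slack a b i v = 0
    · rw [faceSum_eq_zero (show v ∈ cutFace a b J from ⟨hv.1, hJ⟩), Finset.sum_eq_zero hJ]
      simp
    -- At a vertex where some slack in `J` is positive, the sum over `J` is at least `s`, while the
    -- left sum is at most `mS`.
    · push Not at hJ
      obtain ⟨i, hi, hne⟩ := hJ
      have h1 : minSlack a b ≤ ∑ i ∈ J, slack a b i v :=
        (minSlack_le_slack hv (lt_of_le_of_ne (hnn i hi) hne.symm)).trans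
          (Finset.single_le_sum hnn hi)
      have h2 := faceSum_le hbdd (cutFace a b J) hv.1
      have h3 : 0 ≤ (m : ℝ) * maxSlack a b := by positivity
      nlinarith [mul_le_mul_of_nonneg_left h2 hs.le, mul_le_mul_of_nonneg_left h1 h3]

/-- For the empty face this says that the constraints are never all active at a point of `P`. -/
theorem eq_cutFace (hn : 1 ≤ n) (hbdd : Bornology.IsBounded (polyhedron a b))
    (hdim : HasDim (polyhedron a b) n) {k : ℕ} {F : Set (Fin n → ℝ)}
    (hF : F ∈ facesOfRank (polyhedron a b) k) : F = cutFace a b (activeSet a b F) := by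
  refine Set.Subset.antisymm
    (fun x hx => ⟨subset_of_mem_facesOfRank hF hx, fun i hi => mem_activeSet.1 hi x hx⟩) ?_
  rintro x ⟨hx, h⟩
  cases k with
  | zero =>
    obtain rfl : F = ∅ := hF
    obtain ⟨i, hi⟩ := exists_slack_pos_of_mem hn hbdd hdim hx
    exact absurd (h i (by simp [activeSet_empty])) hi.ne'
  | succ k => exact mem_of_isExposed hF.1 hF.2.1 hx h

end Vertices

/-! ### Facets and ridges: which inequalities a point outside violates. -/

section Facets

variable {n m : ℕ} {a : Fin m → Fin n → ℝ} {b : Fin m → ℝ}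

theorem faceSum_pos (hn : 1 ≤ n) (hbdd : Bornology.IsBounded (polyhedron a b))
    (hdim : HasDim (polyhedron a b) n) {k : ℕ} {F : Set (Fin n → ℝ)}
    (hF : F ∈ facesOfRank (polyhedron a b) k) {x : Fin n → ℝ} (hx : x ∈ polyhedron a b)
    (hxF : x ∉ F) : 0 < faceSum a b F x := by
  refine lt_of_le_of_ne (faceSum_nonneg F hx) fun h => hxF ?_
  rw [eq_cutFace hn hbdd hdim hF]
  exact ⟨hx, (Finset.sum_eq_zero_iff_of_nonneg fun i _ => mem_polyhedron_iff.1 hx i).1 h.symm⟩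

theorem slack_sub (i : Fin m) (x y : Fin n → ℝ) :
    slack a b i x - slack a b i y = - (a i ⬝ᵥ (x - y)) := by
  simp only [slack, dotProduct_sub]; ring

theorem mem_ker_iff (i : Fin m) (x y : Fin n → ℝ) :
    x - y ∈ LinearMap.ker (dotProductBilin ℝ ℝ (a i)) ↔ slack a b i x = slack a b i y := by
  have h : dotProductBilin ℝ ℝ (a i) (x - y) = a i ⬝ᵥ (x - y) := rfl
  rw [LinearMap.mem_ker, h, ← sub_eq_zero (b := slack a b i y), slack_sub, neg_eq_zero]

/-- The point at which the segment from `q` to `x` crosses the hyperplane `slack i = 0`. -/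
theorem exists_crossing {i : Fin m} {q x : Fin n → ℝ} (hq : 0 < slack a b i q)
    (hx : slack a b i x < 0) :
    ∃ t : ℝ, 0 < t ∧ t < 1 ∧ slack a b i (q + t • (x - q)) = 0 := by
  have h : 0 < slack a b i q - slack a b i x := by linarith
  refine ⟨slack a b i q / (slack a b i q - slack a b i x), by positivity, ?_, ?_⟩
  · rw [div_lt_one h]; linarith
  · rw [slack_line]
    field_simp
    ring

/-- A point outside of a full-dimensional polytope violates the inequality of some facet. -/
theorem exists_facet_faceSum_neg (hn : 1 ≤ n) (hbdd : Bornology.IsBounded (polyhedron a b))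
    (hdim : HasDim (polyhedron a b) n) {x : Fin n → ℝ} (hx : x ∉ polyhedron a b) :
    ∃ H ∈ facesOfRank (polyhedron a b) n, faceSum a b H x < 0 := by
  obtain ⟨hs, -⟩ := minSlack_pos_le hn hbdd hdim
  have hm := pos_of_hasDim hn hbdd hdim
  obtain ⟨q, hqP, hq⟩ := exists_center hbdd hdim hm
  -- In a minimal subsystem describing `P`, each inequality can be violated alone, and therefore
  -- defines a facet.
  obtain ⟨I, hI⟩ := exists_minimal_of_wellFoundedLT
    (fun I : Finset (Fin m) => ∀ y, (∀ i ∈ I, 0 ≤ slack a b i y) → y ∈ polyhedron a b)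
    ⟨Finset.univ, fun y hy => mem_polyhedron_iff.2 fun i => hy i (Finset.mem_univ i)⟩
  have hirr : ∀ i ∈ I, ∃ y, (∀ j ∈ I, j ≠ i → 0 ≤ slack a b j y) ∧ slack a b i y < 0 := by
    intro i hi
    have h1 := hI.not_prop_of_lt (Finset.erase_ssubset hi)
    push Not at h1
    obtain ⟨y, hy, hyP⟩ := h1
    refine ⟨y, fun j hj hji => hy j (Finset.mem_erase.2 ⟨hji, hj⟩), ?_⟩
    by_contra hc
    push Not at hc
    refine hyP (hI.prop y fun j hj => ?_)
    by_cases hji : j = i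
    · exact hji ▸ hc
    · exact hy j (Finset.mem_erase.2 ⟨hji, hj⟩)
  have hqpos : ∀ i ∈ I, 0 < slack a b i q := by
    intro i hi
    rcases hq i with h | h
    · obtain ⟨y, -, hy⟩ := hirr i hi
      exact absurd (h y) hy.ne
    · exact lt_of_lt_of_le (by positivity) h
  have hviol : ∃ i ∈ I, slack a b i x < 0 := by
    by_contra hc
    push Not at hc
    exact hx (hI.prop x hc)
  obtain ⟨i, hi, hix⟩ := hviol
  obtain ⟨y, hyI, hyi⟩ := hirr i hi
  obtain ⟨t, ht0, ht1, ht⟩ := exists_crossing (hqpos i hi) hyi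
  set w := q + t • (y - q) with hw
  have hwI : ∀ j ∈ I, j ≠ i → 0 < slack a b j w := by
    intro j hj hji
    rw [hw, slack_line]
    have h1 := hqpos j hj
    have h2 := hyI j hj hji
    nlinarith
  have hwP : w ∈ polyhedron a b := hI.prop w fun j hj => by
    by_cases hji : j = i
    · rw [hji, ht]
    · exact (hwI j hj hji).le
  have hwH : w ∈ cutFace a b {i} := ⟨hwP, by simpa using ht⟩
  have hiH : i ∈ activeSet a b (cutFace a b {i}) :=
    subset_activeSet_cutFace _ (Finset.mem_singleton_self i)
  have hspan : vectorSpan ℝ (cutFace a b {i}) = LinearMap.ker (dotProductBilin ℝ ℝ (a i)) := by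
    refine le_antisymm (vectorSpan_le_ker hiH) fun v hv => ?_
    -- All other constraints of `I` are strict at `w`, so small moves inside the hyperplane of `i`
    -- stay in the facet.
    have hev : ∀ j ∈ I, ∀ᶠ ε : ℝ in nhdsWithin 0 (Set.Ioi 0), 0 ≤ slack a b j (w + ε • v) := by
      intro j hj
      by_cases hji : j = i
      · refine Filter.Eventually.of_forall fun ε => ?_
        have h1 : slack a b i (w + ε • v) = slack a b i w :=
          (mem_ker_iff i _ _).1 (by simpa using Submodule.smul_mem _ ε hv)
        rw [hji, h1, ht]
      · have hc : Continuous fun ε : ℝ => slack a b j (w + ε • v) := by fun_prop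
        have := (hc.tendsto 0).eventually_const_lt (u := 0) (by simpa using hwI j hj hji)
        filter_upwards [nhdsWithin_le_nhds this] with ε hε using hε.le
    obtain ⟨ε, hε, hε0⟩ :=
      (((Filter.eventually_all_finset I).2 hev).and self_mem_nhdsWithin).exists
    have hε0' : (0 : ℝ) < ε := hε0
    have h1 : slack a b i (w + ε • v) = slack a b i w :=
      (mem_ker_iff i _ _).1 (by simpa using Submodule.smul_mem _ ε hv)
    have h2 : w + ε • v ∈ cutFace a b {i} := ⟨hI.prop _ hε, by simpa using h1.trans ht⟩
    have h3 := Submodule.smul_mem _ ε⁻¹ (vsub_mem_vectorSpan ℝ h2 hwH)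
    simpa [smul_smul, hε0'.ne'] using h3
  refine ⟨cutFace a b {i}, ?_, ?_⟩
  · obtain ⟨k, rfl⟩ : ∃ k, n = k + 1 := ⟨n - 1, by omega⟩
    refine ⟨isExposed_cutFace _, ⟨w, hwH⟩, ?_⟩
    have hne : dotProductBilin ℝ ℝ (a i) ≠ 0 := by
      intro h
      have h1 : slack a b i q = slack a b i y := (mem_ker_iff i q y).1 (by rw [h]; simp)
      linarith [hqpos i hi]
    have := Module.Dual.finrank_ker_add_one_of_ne_zero hne
    rw [hspan]
    simpa using this
  · obtain ⟨r, hr0, hr1, hr⟩ := exists_crossing (hqpos i hi) hix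
    -- A constraint active on the facet vanishes on the whole hyperplane of `i`. It is nonnegative
    -- at `q`, hence nonpositive at `x`, beyond the crossing.
    have hle : ∀ j ∈ activeSet a b (cutFace a b {i}), slack a b j x ≤ 0 := by
      intro j hj
      have h1 : q + r • (x - q) - w ∈ LinearMap.ker (dotProductBilin ℝ ℝ (a j)) := by
        refine vectorSpan_le_ker hj ?_
        rw [hspan, mem_ker_iff (b := b), hr, ht]
      rw [mem_ker_iff (b := b), mem_activeSet.1 hj w hwH, slack_line] at h1
      have h2 := mem_polyhedron_iff.1 hqP j
      by_contra hc
      push Not at hc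
      nlinarith [mul_pos hr0 hc]
    calc faceSum a b (cutFace a b {i}) x ≤ slack a b i x := by
          rw [faceSum, ← Finset.add_sum_erase _ _ hiH]
          have := Finset.sum_nonpos fun j (hj : j ∈ (activeSet a b (cutFace a b {i})).erase i) =>
            hle j (Finset.mem_of_mem_erase hj)
          linarith
      _ < 0 := hix

/-- Two distinct faces of the same rank each contain a point outside of the other. -/
theorem exists_mem_notMem {k : ℕ} {H H' : Set (Fin n → ℝ)}
    (hH : H ∈ facesOfRank (polyhedron a b) k) (hH' : H' ∈ facesOfRank (polyhedron a b) k)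
    (hne : H ≠ H') : ∃ h ∈ H, h ∉ H' := by
  by_contra hc
  push Not at hc
  exact (rank_lt_of_ssubset hH hH' (Set.ssubset_iff_subset_ne.2 ⟨hc, hne⟩)).false

/-- In dimension one no point violates the inequalities of two vertices. -/
theorem faceSum_facet_pos_of_dim_one {a : Fin m → Fin 1 → ℝ}
    (hbdd : Bornology.IsBounded (polyhedron a b)) (hdim : HasDim (polyhedron a b) 1)
    {H H' : Set (Fin 1 → ℝ)} (hH : H ∈ facesOfRank (polyhedron a b) 1)
    (hH' : H' ∈ facesOfRank (polyhedron a b) 1) (hne : H ≠ H') {x : Fin 1 → ℝ}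
    (hx : faceSum a b H x < 0) : 0 < faceSum a b H' x := by
  obtain ⟨h, hh, hhH'⟩ := exists_mem_notMem hH hH' hne
  obtain ⟨h', hh', hh'H⟩ := exists_mem_notMem hH' hH hne.symm
  have hd : h' 0 - h 0 ≠ 0 := by
    intro e
    apply hh'H
    have : h' = h := by ext j; fin_cases j; simpa [sub_eq_zero] using e
    rwa [this]
  -- With `x = (1 - t) h + t h'`, the value `p_H(x) = t p_H(h')` forces `t < 0`, and `p_H'(x) = (1 -
  -- t) p_H'(h)`.
  set t := (x 0 - h 0) / (h' 0 - h 0) with ht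
  have hxt : x = (1 - t) • h + t • h' := by
    ext j
    fin_cases j
    simp [ht]
    field_simp
    ring
  have h1 := faceSum_pos le_rfl hbdd hdim hH (subset_of_mem_facesOfRank hH' hh') hh'H
  have h2 := faceSum_pos le_rfl hbdd hdim hH' (subset_of_mem_facesOfRank hH hh) hhH'
  rw [hxt, faceSum_comb _ (by ring), faceSum_eq_zero hh] at hx
  rw [hxt, faceSum_comb _ (by ring), faceSum_eq_zero hh']
  have ht0 : t < 0 := by
    by_contra hc
    push Not at hc
    nlinarith [mul_nonneg hc h1.le]
  nlinarith [mul_pos (neg_pos.2 ht0) h2]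

theorem faceSum_eq_of_sub_eq (F : Set (Fin n → ℝ)) {x g w h h' : Fin n → ℝ} {α β : ℝ}
    (hw : ∀ i ∈ activeSet a b F, a i ⬝ᵥ w = 0) (hg : faceSum a b F g = 0)
    (hx : x - g = w + α • (h - g) + β • (h' - g)) :
    faceSum a b F x = α * faceSum a b F h + β * faceSum a b F h' := by
  have h1 : ∀ i ∈ activeSet a b F, slack a b i x = slack a b i g +
      α * (slack a b i h - slack a b i g) + β * (slack a b i h' - slack a b i g) := by
    intro i hi
    rw [← sub_add_cancel (slack a b i x) (slack a b i g), slack_sub, hx, slack_sub, slack_sub]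
    simp only [dotProduct_add, dotProduct_smul, smul_eq_mul, hw i hi]
    ring
  have h2 : faceSum a b F x = faceSum a b F g +
      α * (faceSum a b F h - faceSum a b F g) + β * (faceSum a b F h' - faceSum a b F g) := by
    simp only [faceSum, ← Finset.sum_sub_distrib, Finset.mul_sum, ← Finset.sum_add_distrib]
    exact Finset.sum_congr rfl h1
  rw [h2, hg]
  ring

/-- If two facets meet in a ridge, a point that violates their inequalities violates the
inequality of the ridge. -/
theorem faceSum_ridge_neg (hn : 2 ≤ n) (hbdd : Bornology.IsBounded (polyhedron a b))
    (hdim : HasDim (polyhedron a b) n) {H H' : Set (Fin n → ℝ)}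
    (hH : H ∈ facesOfRank (polyhedron a b) n) (hH' : H' ∈ facesOfRank (polyhedron a b) n)
    (hne : H ≠ H') (hG : H ∩ H' ∈ facesOfRank (polyhedron a b) (n - 1)) {x : Fin n → ℝ}
    (hx : faceSum a b H x < 0) (hx' : faceSum a b H' x ≤ 0) :
    faceSum a b (H ∩ H') x < 0 := by
  obtain ⟨k, rfl⟩ : ∃ k, n = k + 2 := ⟨n - 2, by omega⟩
  obtain ⟨h, hh, hhH'⟩ := exists_mem_notMem hH hH' hne
  obtain ⟨h', hh', hh'H⟩ := exists_mem_notMem hH' hH hne.symm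
  have hG' : HasDim (H ∩ H') k := hG.2
  obtain ⟨⟨g, hgH, hgH'⟩, hfr⟩ := hG'
  have hpos := faceSum_pos (by omega) hbdd hdim hH (subset_of_mem_facesOfRank hH' hh') hh'H
  have hpos' := faceSum_pos (by omega) hbdd hdim hH' (subset_of_mem_facesOfRank hH hh) hhH'
  have hW : ∀ w ∈ vectorSpan ℝ (H ∩ H'), ∀ i ∈ activeSet a b (H ∩ H'), a i ⬝ᵥ w = 0 :=
    fun w hw i hi => by simpa [dotProductBilin] using vectorSpan_le_ker hi hw
  have hIH := activeSet_anti (a := a) (b := b) (Set.inter_subset_left : H ∩ H' ⊆ H)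
  have hIH' := activeSet_anti (a := a) (b := b) (Set.inter_subset_right : H ∩ H' ⊆ H')
  have hlt₁ : vectorSpan ℝ (H ∩ H') < vectorSpan ℝ (H ∩ H') ⊔ Submodule.span ℝ {h - g} := by
    refine lt_of_le_of_ne le_sup_left fun e => ?_
    have hmem : h - g ∈ vectorSpan ℝ (H ∩ H') := by
      rw [e]
      exact Submodule.mem_sup_right (Submodule.mem_span_singleton_self _)
    have := faceSum_eq_of_sub_eq (x := h) (h := g) (h' := g) (α := 0) (β := 0) H'
      (fun i hi => hW _ hmem i (hIH' hi)) (faceSum_eq_zero hgH') (by simp)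
    linarith
  have hlt₂ : vectorSpan ℝ (H ∩ H') ⊔ Submodule.span ℝ {h - g} <
      (vectorSpan ℝ (H ∩ H') ⊔ Submodule.span ℝ {h - g}) ⊔ Submodule.span ℝ {h' - g} := by
    refine lt_of_le_of_ne le_sup_left fun e => ?_
    have hmem : h' - g ∈ vectorSpan ℝ (H ∩ H') ⊔ Submodule.span ℝ {h - g} := by
      rw [e]
      exact Submodule.mem_sup_right (Submodule.mem_span_singleton_self _)
    obtain ⟨w, hw, z, hz, hwz⟩ := Submodule.mem_sup.1 hmem
    obtain ⟨α, rfl⟩ := Submodule.mem_span_singleton.1 hz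
    have := faceSum_eq_of_sub_eq (x := h') (h := h) (h' := g) (α := α) (β := 0) H
      (fun i hi => hW _ hw i (hIH hi)) (faceSum_eq_zero hgH) (by simp [hwz])
    rw [faceSum_eq_zero hh] at this
    linarith
  -- Adding `h - g` and then `h' - g` raises the dimension twice, from `k` to `k + 2`.
  have htop : (vectorSpan ℝ (H ∩ H') ⊔ Submodule.span ℝ {h - g}) ⊔
      Submodule.span ℝ {h' - g} = ⊤ := by
    have h1 := Submodule.finrank_lt_finrank_of_lt hlt₁
    have h2 := Submodule.finrank_lt_finrank_of_lt hlt₂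
    refine Submodule.eq_top_of_finrank_eq (le_antisymm (Submodule.finrank_le _) ?_)
    rw [Module.finrank_fin_fun]
    omega
  have hmem : x - g ∈ (vectorSpan ℝ (H ∩ H') ⊔ Submodule.span ℝ {h - g}) ⊔
      Submodule.span ℝ {h' - g} := htop ▸ Submodule.mem_top
  obtain ⟨y, hy, z, hz, hyz⟩ := Submodule.mem_sup.1 hmem
  obtain ⟨β, rfl⟩ := Submodule.mem_span_singleton.1 hz
  obtain ⟨w, hw, z, hz, rfl⟩ := Submodule.mem_sup.1 hy
  obtain ⟨α, rfl⟩ := Submodule.mem_span_singleton.1 hz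
  have e₁ := faceSum_eq_of_sub_eq H (fun i hi => hW _ hw i (hIH hi)) (faceSum_eq_zero hgH) hyz.symm
  have e₂ := faceSum_eq_of_sub_eq H' (fun i hi => hW _ hw i (hIH' hi)) (faceSum_eq_zero hgH')
    hyz.symm
  have e₃ := faceSum_eq_of_sub_eq (H ∩ H') (hW _ hw)
    (faceSum_eq_zero (show g ∈ H ∩ H' from ⟨hgH, hgH'⟩)) hyz.symm
  rw [faceSum_eq_zero hh, mul_zero, zero_add] at e₁
  rw [faceSum_eq_zero hh', mul_zero, add_zero] at e₂
  -- `p_H` sees only `β` and `p_H'` only `α`; the ridge sum is `α p(h) + β p(h')`.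
  have hβ : β < 0 := by
    by_contra hc
    push Not at hc
    nlinarith [mul_nonneg hc hpos.le]
  have hα : α ≤ 0 := by
    by_contra hc
    push Not at hc
    nlinarith [mul_pos hc hpos']
  have h₁ := faceSum_nonneg (H ∩ H') (subset_of_mem_facesOfRank hH hh)
  have h₂ := faceSum_pos (by omega) hbdd hdim hG (subset_of_mem_facesOfRank hH' hh')
    fun hc => hh'H hc.1
  rw [e₃]
  nlinarith [mul_nonneg (neg_nonneg.2 hα) h₁, mul_pos (neg_pos.2 hβ) h₂]

end Facets

/-! ### What the sign of `p_{F,δ,K}` says about the slacks. -/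

section PowPoly

variable {n m : ℕ} {a : Fin m → Fin n → ℝ} {b : Fin m → ℝ}

theorem powPoly_nonneg_of_abs_le {δ : ℝ} (hδ : 0 ≤ δ) (K : ℕ) (F : Set (Fin n → ℝ))
    {x : Fin n → ℝ}
    (h : ∀ i ∈ activeSet a b F, |2 * slack a b i x - faceSum a b F x| ≤ |faceSum a b F x|) :
    0 ≤ eval x (powPoly a b δ K F) := by
  rw [eval_powPoly, sub_nonneg, ← (even_two_mul K).pow_abs ((1 + δ) * _), abs_mul,
    abs_of_nonneg (by linarith : 0 ≤ 1 + δ)]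
  have hle : |faceSum a b F x| ^ (2 * K) ≤ ((1 + δ) * |faceSum a b F x|) ^ (2 * K) := by
    gcongr
    nlinarith [abs_nonneg (faceSum a b F x)]
  refine le_trans ?_ hle
  have hsum : ∑ i ∈ activeSet a b F, (2 * slack a b i x - faceSum a b F x) ^ (2 * K) ≤
      (activeSet a b F).card * |faceSum a b F x| ^ (2 * K) := by
    rw [← nsmul_eq_mul]
    refine Finset.sum_le_card_nsmul _ _ _ fun i hi => ?_
    rw [← (even_two_mul K).pow_abs]
    exact pow_le_pow_left₀ (abs_nonneg _) (h i hi) _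
  -- For an empty active set the inverse of 0 is 0, so the subtracted term vanishes.
  rcases (activeSet a b F).card.eq_zero_or_pos with h0 | h0
  · rw [h0]
    simp only [Nat.cast_zero, inv_zero, zero_mul]
    positivity
  · rw [inv_mul_le_iff₀ (by positivity)]
    exact hsum

theorem powPoly_nonneg {δ : ℝ} (hδ : 0 ≤ δ) (K : ℕ) (F : Set (Fin n → ℝ)) {x : Fin n → ℝ}
    (hx : x ∈ polyhedron a b) : 0 ≤ eval x (powPoly a b δ K F) := by
  refine powPoly_nonneg_of_abs_le hδ K F fun i hi => ?_
  have h0 := mem_polyhedron_iff.1 hx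
  have h1 : slack a b i x ≤ faceSum a b F x :=
    Finset.single_le_sum (f := fun j => slack a b j x) (fun j _ => h0 j) hi
  rw [abs_of_nonneg (faceSum_nonneg F hx), abs_le]
  constructor <;> linarith [h0 i]

/-- An active slack is the sum `p` minus at most `m` terms, each at least `-δp/(4m)`, so it is at
most `(1 + δ/4)p`. Hence every base in the mean is at most `(1 + δ/2)p` in absolute value. -/
theorem powPoly_pos {δ : ℝ} (hδ : 0 < δ) {K : ℕ} (hK : K ≠ 0) {F : Set (Fin n → ℝ)}
    {x : Fin n → ℝ} (hm : 0 < m) (hp : 0 < faceSum a b F x)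
    (h : ∀ i ∈ activeSet a b F, -(δ / (4 * m) * faceSum a b F x) ≤ slack a b i x) :
    0 < eval x (powPoly a b δ K F) := by
  have hm' : (1 : ℝ) ≤ m := by exact_mod_cast hm
  have hη : m * (δ / (4 * m)) = δ / 4 := by field_simp
  set η := δ / (4 * m) with hη'
  have hη0 : 0 < η := by positivity
  have hηδ : η ≤ δ / 4 := by nlinarith
  set p := faceSum a b F x with hpdef
  have habs : ∀ i ∈ activeSet a b F, |2 * slack a b i x - p| ≤ (1 + δ / 2) * p := by
    intro i hi
    have h1 : p = slack a b i x + ∑ j ∈ (activeSet a b F).erase i, slack a b j x :=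
      (Finset.add_sum_erase _ (fun j => slack a b j x) hi).symm
    have h2 : ((activeSet a b F).erase i).card • (-(η * p)) ≤
        ∑ j ∈ (activeSet a b F).erase i, slack a b j x :=
      Finset.card_nsmul_le_sum _ _ _ fun j hj => h j (Finset.mem_of_mem_erase hj)
    have h3 : (((activeSet a b F).erase i).card : ℝ) ≤ m := by
      exact_mod_cast (Finset.card_le_univ _).trans_eq (Fintype.card_fin m)
    rw [nsmul_eq_mul] at h2
    have h4 := mul_le_mul_of_nonneg_right h3 (mul_pos hη0 hp).le
    have h5 : (m : ℝ) * (η * p) = δ / 4 * p := by rw [← mul_assoc, hη]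
    have h6 := h i hi
    have h7 := mul_le_mul_of_nonneg_right hηδ hp.le
    rw [abs_le]
    constructor <;> nlinarith
  rw [eval_powPoly, sub_pos]
  have hlt : ((1 + δ / 2) * p) ^ (2 * K) < ((1 + δ) * p) ^ (2 * K) := by
    refine pow_lt_pow_left₀ ?_ (by positivity) (by omega)
    nlinarith
  have hsum : ∑ i ∈ activeSet a b F, (2 * slack a b i x - p) ^ (2 * K) ≤
      (activeSet a b F).card * ((1 + δ / 2) * p) ^ (2 * K) := by
    rw [← nsmul_eq_mul]
    refine Finset.sum_le_card_nsmul _ _ _ fun i hi => ?_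
    rw [← (even_two_mul K).pow_abs]
    exact pow_le_pow_left₀ (abs_nonneg _) (habs i hi) _
  refine lt_of_le_of_lt ?_ hlt
  rcases (activeSet a b F).card.eq_zero_or_pos with h0 | h0
  · rw [h0]
    simp only [Nat.cast_zero, inv_zero, zero_mul]
    positivity
  · rw [inv_mul_le_iff₀ (by positivity)]
    exact hsum

/-- One term is at most `|I_F|` times the mean, and `K ≥ m/δ` brings the `2K`-th root of `|I_F|`
below `1 + δ/2`. -/
theorem abs_le_of_powPoly_nonneg {δ : ℝ} (hδ : 0 < δ) (hδ1 : δ ≤ 1) {K : ℕ}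
    (hK : m / δ ≤ K) {F : Set (Fin n → ℝ)} {x : Fin n → ℝ}
    (h : 0 ≤ eval x (powPoly a b δ K F)) {i : Fin m} (hi : i ∈ activeSet a b F) :
    |2 * slack a b i x - faceSum a b F x| ≤ (1 + 2 * δ) * |faceSum a b F x| := by
  have hm : 0 < m := i.pos
  rw [div_le_iff₀ hδ] at hK
  have hK0 : K ≠ 0 := by
    rintro rfl
    have : (0 : ℝ) < m := by exact_mod_cast hm
    simp at hK
    omega
  set p := faceSum a b F x with hp
  rw [eval_powPoly, sub_nonneg] at h
  have hcard : 0 < (activeSet a b F).card := Finset.card_pos.2 ⟨i, hi⟩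
  rw [inv_mul_le_iff₀ (by exact_mod_cast hcard)] at h
  have h1 : (2 * slack a b i x - p) ^ (2 * K) ≤
      ∑ i ∈ activeSet a b F, (2 * slack a b i x - p) ^ (2 * K) :=
    Finset.single_le_sum (f := fun i => (2 * slack a b i x - p) ^ (2 * K))
      (fun j _ => (even_two_mul K).pow_nonneg _) hi
  have h2 : ((activeSet a b F).card : ℝ) ≤ (1 + δ / 2) ^ (2 * K) := by
    have h3 : ((activeSet a b F).card : ℝ) ≤ m := by
      exact_mod_cast (Finset.card_le_univ _).trans_eq (Fintype.card_fin m)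
    -- Bernoulli: `(1 + δ/2)^(2K) ≥ 1 + Kδ ≥ 1 + m`.
    have h4 := one_add_mul_le_pow (a := δ / 2) (by linarith) (2 * K)
    push_cast at h4
    linarith
  have h3 : |2 * slack a b i x - p| ^ (2 * K) ≤ ((1 + δ / 2) * ((1 + δ) * |p|)) ^ (2 * K) := by
    rw [(even_two_mul K).pow_abs, mul_pow _ ((1 + δ) * |p|), mul_pow _ |p|,
      (even_two_mul K).pow_abs, ← mul_pow _ p]
    exact (h1.trans h).trans (mul_le_mul_of_nonneg_right h2 ((even_two_mul K).pow_nonneg _))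
  have h4 := le_of_pow_le_pow_left₀ (by omega) (by positivity) h3
  have h5 : (1 + δ / 2) * (1 + δ) ≤ 1 + 2 * δ := by nlinarith
  nlinarith [mul_le_mul_of_nonneg_right h5 (abs_nonneg p)]

end PowPoly

/-! ### Bounds for `τ`, `δ_r` and `K_r`. -/

section Parameters

variable {n m : ℕ} {a : Fin m → Fin n → ℝ} {b : Fin m → ℝ}

theorem tau_mul (hn : 1 ≤ n) (hbdd : Bornology.IsBounded (polyhedron a b))
    (hdim : HasDim (polyhedron a b) n) :
    tau a b * (32 * (m : ℝ) ^ 3 * maxSlack a b ^ 2) = minSlack a b ^ 2 := by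
  obtain ⟨hs, hsS⟩ := minSlack_pos_le hn hbdd hdim
  have hm := pos_of_hasDim hn hbdd hdim
  have hS : 0 < maxSlack a b := hs.trans_le hsS
  exact div_mul_cancel₀ _ (by positivity)

theorem tau_pos (hn : 1 ≤ n) (hbdd : Bornology.IsBounded (polyhedron a b))
    (hdim : HasDim (polyhedron a b) n) : 0 < tau a b := by
  obtain ⟨hs, hsS⟩ := minSlack_pos_le hn hbdd hdim
  have hm := pos_of_hasDim hn hbdd hdim
  have hS : 0 < maxSlack a b := hs.trans_le hsS
  unfold tau
  positivity

theorem mul_tau_le (hn : 1 ≤ n) (hbdd : Bornology.IsBounded (polyhedron a b))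
    (hdim : HasDim (polyhedron a b) n) : m * tau a b ≤ 1 / 32 := by
  obtain ⟨hs, hsS⟩ := minSlack_pos_le hn hbdd hdim
  have hm : (1 : ℝ) ≤ m := by exact_mod_cast pos_of_hasDim hn hbdd hdim
  have hS : 0 < maxSlack a b := hs.trans_le hsS
  have hτ := tau_pos hn hbdd hdim
  have h1 := tau_mul hn hbdd hdim
  have h2 : minSlack a b ^ 2 ≤ maxSlack a b ^ 2 := by gcongr
  have h3 : m * tau a b * maxSlack a b ^ 2 * 32 ≤ maxSlack a b ^ 2 := by
    calc m * tau a b * maxSlack a b ^ 2 * 32 ≤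
        m * tau a b * maxSlack a b ^ 2 * 32 * (m : ℝ) ^ 2 :=
          le_mul_of_one_le_right (by positivity) (one_le_pow₀ hm)
      _ = minSlack a b ^ 2 := by rw [← h1]; ring
      _ ≤ _ := h2
  have h4 : (0 : ℝ) < maxSlack a b ^ 2 := by positivity
  by_contra hc
  push Not at hc
  nlinarith [mul_lt_mul_of_pos_right hc h4]

theorem tau_le (hn : 1 ≤ n) (hbdd : Bornology.IsBounded (polyhedron a b))
    (hdim : HasDim (polyhedron a b) n) : tau a b ≤ 1 / 32 := by
  have hm : (1 : ℝ) ≤ m := by exact_mod_cast pos_of_hasDim hn hbdd hdim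
  have := mul_tau_le hn hbdd hdim
  have := tau_pos hn hbdd hdim
  nlinarith

theorem tau_le_one (hn : 1 ≤ n) (hbdd : Bornology.IsBounded (polyhedron a b))
    (hdim : HasDim (polyhedron a b) n) : tau a b ≤ 1 :=
  (tau_le hn hbdd hdim).trans (by norm_num)

theorem delta_pos (hn : 1 ≤ n) (hbdd : Bornology.IsBounded (polyhedron a b))
    (hdim : HasDim (polyhedron a b) n) (r : ℕ) : 0 < delta a b r :=
  pow_pos (tau_pos hn hbdd hdim) _

theorem delta_le_one (hn : 1 ≤ n) (hbdd : Bornology.IsBounded (polyhedron a b))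
    (hdim : HasDim (polyhedron a b) n) (r : ℕ) : delta a b r ≤ 1 :=
  pow_le_one₀ (tau_pos hn hbdd hdim).le (tau_le_one hn hbdd hdim)

theorem delta_eq {r : ℕ} (hr : r + 2 ≤ n) : delta a b r = tau a b ^ (n - 2 - r) * tau a b := by
  rw [delta, ← pow_succ]
  congr 1
  omega

theorem delta_le_tau (hbdd : Bornology.IsBounded (polyhedron a b))
    (hdim : HasDim (polyhedron a b) n) {r : ℕ} (hr : r + 2 ≤ n) : delta a b r ≤ tau a b := by
  have hn : 1 ≤ n := by omega
  have hτ := tau_pos hn hbdd hdim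
  rw [delta_eq hr]
  exact mul_le_of_le_one_left hτ.le (pow_le_one₀ hτ.le (tau_le_one hn hbdd hdim))

theorem expo_ne_zero (hn : 1 ≤ n) (hbdd : Bornology.IsBounded (polyhedron a b))
    (hdim : HasDim (polyhedron a b) n) (r : ℕ) : expo a b r ≠ 0 := by
  have := delta_pos hn hbdd hdim r
  have := pos_of_hasDim hn hbdd hdim
  exact (Nat.ceil_pos.2 (by positivity)).ne'

end Parameters

/-! ### Points near a face, and small sums of slacks there. -/

section Near

variable {n m : ℕ} {a : Fin m → Fin n → ℝ} {b : Fin m → ℝ}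

theorem cutFace_union (I J : Finset (Fin m)) :
    cutFace a b (I ∪ J) = cutFace a b I ∩ cutFace a b J := by
  ext x
  simp only [cutFace, Set.mem_inter_iff, Set.mem_ofPred_eq, Finset.mem_union]
  grind

/-- The point `x` violates the constraints active on the face `F` of rank `r` by little compared to
the sum of their slacks, which is positive and is a lower bound for all the other slacks. -/
structure NearFace (a : Fin m → Fin n → ℝ) (b : Fin m → ℝ) (r : ℕ) (F : Set (Fin n → ℝ))
    (x : Fin n → ℝ) : Prop where
  rank : F ∈ facesOfRank (polyhedron a b) r
  pos : 0 < faceSum a b F x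
  lower : ∀ i, -(delta a b r * faceSum a b F x) ≤ slack a b i x
  le_slack : ∀ i ∉ activeSet a b F, faceSum a b F x ≤ slack a b i x

variable {r : ℕ} {F : Set (Fin n → ℝ)} {x : Fin n → ℝ}

/-- If two sums of slacks are small at a point near a face, then so is the sum of the slacks of
the constraints that they force to be active. -/
theorem NearFace.faceSum_cutFace_lt (hx : NearFace a b r F x) (hr : r + 2 ≤ n)
    (hbdd : Bornology.IsBounded (polyhedron a b)) (hdim : HasDim (polyhedron a b) n)
    {I J : Finset (Fin m)} {e : ℕ} (he : e + r + 2 ≤ n)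
    (h : ∑ i ∈ I, slack a b i x + ∑ i ∈ J, slack a b i x ≤
      8 * m * tau a b ^ (e + 1) * faceSum a b F x) :
    faceSum a b (cutFace a b (I ∪ J)) x < tau a b ^ e * faceSum a b F x := by
  have hn : 1 ≤ n := by omega
  obtain ⟨hs, hsS⟩ := minSlack_pos_le hn hbdd hdim
  have hm := pos_of_hasDim hn hbdd hdim
  have hτ := tau_pos hn hbdd hdim
  have hτ1 := tau_le_one hn hbdd hdim
  have hτm := tau_mul hn hbdd hdim
  have hδ := delta_pos hn hbdd hdim r
  obtain ⟨q, hqP, hq⟩ := exists_center hbdd hdim hm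
  have hm1 : (1 : ℝ) ≤ m := by exact_mod_cast hm
  set s := minSlack a b
  set S := maxSlack a b
  set τ := tau a b
  set w := faceSum a b F x with hw
  have hw0 : 0 < w := hx.pos
  have hS : 0 < S := hs.trans_le hsS
  -- Chosen so that `θ s/m = δ_r w`: mixing in the centre `q` then repairs every violation, so that
  -- `z ∈ P` and the estimate valid on `P` applies to `z`.
  set θ := delta a b r * w * m / s with hθ
  have hθ0 : 0 < θ := by positivity
  have hsum1 : 1 / (1 + θ) + θ / (1 + θ) = 1 := by field_simp
  set z := (1 / (1 + θ)) • x + (θ / (1 + θ)) • q with hz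
  have hzP : z ∈ polyhedron a b := by
    refine mem_polyhedron_iff.2 fun i => ?_
    rw [hz, slack_comb i hsum1]
    have h1 : 0 ≤ slack a b i x + θ * slack a b i q := by
      rcases hq i with h0 | h0
      · simp [h0]
      · have h2 := mul_le_mul_of_nonneg_left h0 hθ0.le
        have h3 : θ * (s / m) = delta a b r * w := by
          rw [hθ]; field_simp
        linarith [hx.lower i]
    have h2 : 1 / (1 + θ) * slack a b i x + θ / (1 + θ) * slack a b i q =
        (slack a b i x + θ * slack a b i q) / (1 + θ) := by ring
    rw [h2]
    positivity
  have hnn : ∀ J : Finset (Fin m), ∀ y ∈ polyhedron a b, 0 ≤ ∑ i ∈ J, slack a b i y :=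
    fun J y hy => Finset.sum_nonneg fun i _ => mem_polyhedron_iff.1 hy i
  have hle : ∀ J : Finset (Fin m), ∑ i ∈ J, slack a b i q ≤ m * S := by
    intro J
    calc ∑ i ∈ J, slack a b i q ≤ ∑ i, slack a b i q :=
          Finset.sum_le_sum_of_subset_of_nonneg (Finset.subset_univ _)
            fun i _ _ => mem_polyhedron_iff.1 hqP i
      _ ≤ ∑ _i : Fin m, S := Finset.sum_le_sum fun i _ => slack_le_maxSlack_of_mem hbdd i hqP
      _ = m * S := by simp
  have h1 : s * faceSum a b (cutFace a b (I ∪ J)) z ≤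
      m * S * (∑ i ∈ I, slack a b i z + ∑ i ∈ J, slack a b i z) := by
    refine (faceSum_cutFace_le hn hbdd hdim (I ∪ J) hzP).trans ?_
    refine mul_le_mul_of_nonneg_left ?_ (by positivity)
    rw [← Finset.sum_union_inter]
    linarith [hnn (I ∩ J) z hzP]
  have hzsum : ∀ J : Finset (Fin m), ∑ i ∈ J, slack a b i z =
      (∑ i ∈ J, slack a b i x + θ * ∑ i ∈ J, slack a b i q) / (1 + θ) := by
    intro J
    simp only [hz, slack_comb _ hsum1, Finset.sum_add_distrib, ← Finset.mul_sum]
    ring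
  rw [faceSum, hzsum, hzsum, hzsum, ← add_div, ← mul_div_assoc, ← mul_div_assoc,
    div_le_div_iff_of_pos_right (by positivity)] at h1
  have h2 : s * faceSum a b (cutFace a b (I ∪ J)) x ≤
      m * S * (8 * m * τ ^ (e + 1) * w) + θ * (m * S * (2 * (m * S))) := by
    have h3 := hnn (activeSet a b (cutFace a b (I ∪ J))) q hqP
    have h4 : 0 ≤ s * (θ * ∑ i ∈ activeSet a b (cutFace a b (I ∪ J)), slack a b i q) := by
      positivity
    have h5 := mul_le_mul_of_nonneg_left h (by positivity : 0 ≤ m * S)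
    have h6 := mul_le_mul_of_nonneg_left (add_le_add (hle I) (hle J))
      (by positivity : 0 ≤ m * S * θ)
    unfold faceSum
    nlinarith
  have hδe : delta a b r ≤ τ ^ (e + 1) := pow_le_pow_of_le_one hτ.le hτ1 (by omega)
  -- The factor `32m³S²` in `τ` keeps the two error terms below 1/16 and 1/4 of the target.
  have h3 : s * (θ * (m * S * (2 * (m * S)))) ≤ s ^ 2 * (τ ^ e * w) / 16 := by
    have e1 : s * (θ * (m * S * (2 * (m * S)))) = delta a b r * (w * (2 * m ^ 3 * S ^ 2)) := by
      rw [hθ]; field_simp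
    rw [e1, ← hτm]
    calc delta a b r * (w * (2 * m ^ 3 * S ^ 2)) ≤ τ ^ (e + 1) * (w * (2 * m ^ 3 * S ^ 2)) :=
          mul_le_mul_of_nonneg_right hδe (by positivity)
      _ = _ := by ring
  have h4 : s * (m * S * (8 * m * τ ^ (e + 1) * w)) ≤ s ^ 2 * (τ ^ e * w) / 4 := by
    rw [← hτm]
    have e2 : τ * (32 * m ^ 3 * S ^ 2) * (τ ^ e * w) / 4 = 
        (8 * m ^ 2 * τ ^ (e + 1) * w * S) * (m * S) := by
      ring
    have e3 : s * (m * S * (8 * m * τ ^ (e + 1) * w)) = (8 * m ^ 2 * τ ^ (e + 1) * w * S) * s := by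
      ring
    rw [e2, e3]
    refine mul_le_mul_of_nonneg_left ?_ (by positivity)
    nlinarith
  have h5 : s * (s * faceSum a b (cutFace a b (I ∪ J)) x) < s * (s * (τ ^ e * w)) := by
    have h6 := mul_le_mul_of_nonneg_left h2 hs.le
    have h7 : 0 < s ^ 2 * (τ ^ e * w) := by positivity
    nlinarith
  exact lt_of_mul_lt_mul_left (lt_of_mul_lt_mul_left h5 hs.le) hs.le

/-- A face whose sum of slacks is small at a point near `F` contains `F`. -/
theorem NearFace.subset_of_faceSum_lt (hx : NearFace a b r F x) (hr : r + 2 ≤ n)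
    (hbdd : Bornology.IsBounded (polyhedron a b)) (hdim : HasDim (polyhedron a b) n) {k : ℕ}
    {G : Set (Fin n → ℝ)} (hG : G ∈ facesOfRank (polyhedron a b) k)
    (h : faceSum a b G x < 4 * m * tau a b * faceSum a b F x) : F ⊆ G := by
  have hn : 1 ≤ n := by omega
  have hIG : activeSet a b G ⊆ activeSet a b F := by
    intro i hi
    by_contra hc
    -- The slack of such an `i` is at least `p_F`, and the other terms lose at most `mτ p_F ≤
    -- p_F/32`, whereas `4mτ ≤ 1/8`.
    have h1 := hx.le_slack i hc
    have h2 : ((activeSet a b G).erase i).card • (-(delta a b r * faceSum a b F x)) ≤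
        ∑ j ∈ (activeSet a b G).erase i, slack a b j x :=
      Finset.card_nsmul_le_sum _ _ _ fun j _ => hx.lower j
    have h3 : (((activeSet a b G).erase i).card : ℝ) ≤ m := by
      exact_mod_cast (Finset.card_le_univ _).trans_eq (Fintype.card_fin m)
    rw [nsmul_eq_mul] at h2
    have h4 : faceSum a b G x = slack a b i x + ∑ j ∈ (activeSet a b G).erase i, slack a b j x :=
      (Finset.add_sum_erase _ (fun j => slack a b j x) hi).symm
    have h5 := mul_le_mul_of_nonneg_right h3 (mul_pos (delta_pos hn hbdd hdim r) hx.pos).le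
    have h6 : (m : ℝ) * (delta a b r * faceSum a b F x) ≤
        m * (tau a b * faceSum a b F x) := by
      have := delta_le_tau hbdd hdim hr
      have := hx.pos
      gcongr
    have h7 := mul_le_mul_of_nonneg_right (mul_tau_le hn hbdd hdim) hx.pos.le
    nlinarith [hx.pos]
  intro y hy
  rw [eq_cutFace hn hbdd hdim hG]
  exact ⟨subset_of_mem_facesOfRank hx.rank hy, fun i hi => mem_activeSet.1 (hIG hi) y hy⟩

end Near

theorem exists_ne_nonpos_of_prod_nonneg {ι : Type*} {s : Finset ι} {f : ι → ℝ}
    (h : 0 ≤ ∏ j ∈ s, f j) {i : ι} (hi : i ∈ s) (hfi : f i < 0) :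
    ∃ j ∈ s, j ≠ i ∧ f j ≤ 0 := by
  classical
  by_contra hc
  push Not at hc
  rw [← Finset.mul_prod_erase s f hi] at h
  have := Finset.prod_pos fun j (hj : j ∈ s.erase i) =>
    hc j (Finset.mem_of_mem_erase hj) (Finset.ne_of_mem_erase hj)
  nlinarith

/-! ### Passing from a face to a larger one until the point is in `P`. -/

section Chain

variable {n m : ℕ} {a : Fin m → Fin n → ℝ} {b : Fin m → ℝ}
  {r K : ℕ} {F G : Set (Fin n → ℝ)} {x : Fin n → ℝ}

theorem four_mul_tau_pow_le (hn : 1 ≤ n) (hbdd : Bornology.IsBounded (polyhedron a b))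
    (hdim : HasDim (polyhedron a b) n) {j : ℕ} (hj : 1 ≤ j) :
    4 * m * tau a b ^ j ≤ 4 * m * tau a b := by
  have hτ := tau_pos hn hbdd hdim
  have := pow_le_of_le_one hτ.le (tau_le_one hn hbdd hdim) (by omega : j ≠ 0)
  gcongr

/-- Every face of rank strictly between `r` and `K` has a large sum of slacks at `x`, compared to
the sum `w`. -/
def FarFromRanks (a : Fin m → Fin n → ℝ) (b : Fin m → ℝ) (r K : ℕ) (w : ℝ) (x : Fin n → ℝ) :
    Prop :=
  ∀ k, r < k → k < K → ∀ G ∈ facesOfRank (polyhedron a b) k,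
    4 * m * tau a b ^ (k - r) * w ≤ faceSum a b G x

/-- The lower bound that `NearFace.faceSum_cutFace_lt` with `e = K - 1 - r` contradicts. -/
theorem NearFace.le_faceSum (hx : NearFace a b r F x) (hr : r + 2 ≤ n)
    (hbdd : Bornology.IsBounded (polyhedron a b)) (hdim : HasDim (polyhedron a b) n)
    (hfar : FarFromRanks a b r K (faceSum a b F x) x) {k : ℕ} (hk : k < K)
    (hG : G ∈ facesOfRank (polyhedron a b) k) (hFG : F ⊆ G) :
    tau a b ^ (K - 1 - r) * faceSum a b F x ≤ faceSum a b G x := by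
  have hn : 1 ≤ n := by omega
  have hτ := tau_pos hn hbdd hdim
  have hτ1 := tau_le_one hn hbdd hdim
  have hm : (1 : ℝ) ≤ m := by exact_mod_cast pos_of_hasDim hn hbdd hdim
  have hw := hx.pos
  rcases eq_or_ne F G with rfl | hne
  · exact mul_le_of_le_one_left hw.le (pow_le_one₀ hτ.le hτ1)
  · have hrk := rank_lt_of_ssubset hx.rank hG (Set.ssubset_iff_subset_ne.2 ⟨hFG, hne⟩)
    refine le_trans ?_ (hfar k hrk hk G hG)
    have h1 : tau a b ^ (K - 1 - r) ≤ tau a b ^ (k - r) :=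
      pow_le_pow_of_le_one hτ.le hτ1 (by omega)
    have h2 : tau a b ^ (k - r) ≤ 4 * m * tau a b ^ (k - r) :=
      le_mul_of_one_le_left (by positivity) (by linarith)
    exact mul_le_mul_of_nonneg_right (h1.trans h2) hw.le

theorem NearFace.subset_of_faceSum_lt_pow (hx : NearFace a b r F x) (hr : r + 2 ≤ n)
    (hbdd : Bornology.IsBounded (polyhedron a b)) (hdim : HasDim (polyhedron a b) n)
    {k : ℕ} (hrk : r < k) (hG : G ∈ facesOfRank (polyhedron a b) k)
    (h : faceSum a b G x < 4 * m * tau a b ^ (k - r) * faceSum a b F x) : F ⊆ G :=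
  hx.subset_of_faceSum_lt hr hbdd hdim hG <| h.trans_le <| mul_le_mul_of_nonneg_right
    (four_mul_tau_pow_le (by omega) hbdd hdim (by omega)) hx.pos.le

theorem inter_eq_cutFace (hn : 1 ≤ n) (hbdd : Bornology.IsBounded (polyhedron a b))
    (hdim : HasDim (polyhedron a b) n) {k k' : ℕ} {G G' : Set (Fin n → ℝ)}
    (hG : G ∈ facesOfRank (polyhedron a b) k) (hG' : G' ∈ facesOfRank (polyhedron a b) k') :
    G ∩ G' = cutFace a b (activeSet a b G ∪ activeSet a b G') := by
  rw [cutFace_union, ← eq_cutFace hn hbdd hdim hG, ← eq_cutFace hn hbdd hdim hG']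

/-- The meet of two distinct faces of the same rank is a face of smaller rank. -/
theorem exists_rank_inter (hn : 1 ≤ n) (hbdd : Bornology.IsBounded (polyhedron a b))
    (hdim : HasDim (polyhedron a b) n) {k : ℕ} {G G' : Set (Fin n → ℝ)}
    (hG : G ∈ facesOfRank (polyhedron a b) k) (hG' : G' ∈ facesOfRank (polyhedron a b) k)
    (hne : G ≠ G') : ∃ j < k, G ∩ G' ∈ facesOfRank (polyhedron a b) j := by
  obtain ⟨j, hj⟩ := exists_rank_cutFace (a := a) (b := b) (activeSet a b G ∪ activeSet a b G')
  rw [← inter_eq_cutFace hn hbdd hdim hG hG'] at hj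
  refine ⟨j, rank_lt_of_ssubset hj hG ?_, hj⟩
  obtain ⟨h, hh, hh'⟩ := exists_mem_notMem hG hG' hne
  exact Set.ssubset_iff_subset_ne.2 ⟨Set.inter_subset_left, fun e => hh' (e.symm.subset hh).2⟩

/-- Otherwise the meet of `G` and `G'` would be a face of rank below `K` containing `F` with too
small a sum. -/
theorem NearFace.eq_of_faceSum_lt (hx : NearFace a b r F x) (hr : r + 2 ≤ n)
    (hbdd : Bornology.IsBounded (polyhedron a b)) (hdim : HasDim (polyhedron a b) n)
    (hrK : r < K) (hK : K + 1 ≤ n) (hfar : FarFromRanks a b r K (faceSum a b F x) x)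
    {G' : Set (Fin n → ℝ)}
    (hG : G ∈ facesOfRank (polyhedron a b) K) (hG' : G' ∈ facesOfRank (polyhedron a b) K)
    (h : faceSum a b G x < 4 * m * tau a b ^ (K - r) * faceSum a b F x)
    (h' : faceSum a b G' x < 4 * m * tau a b ^ (K - r) * faceSum a b F x) : G = G' := by
  have hn : 1 ≤ n := by omega
  by_contra hne
  obtain ⟨j, hj, hGG'⟩ := exists_rank_inter hn hbdd hdim hG hG' hne
  have h1 := hx.le_faceSum hr hbdd hdim hfar hj hGG' (Set.subset_inter
    (hx.subset_of_faceSum_lt_pow hr hbdd hdim hrK hG h)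
    (hx.subset_of_faceSum_lt_pow hr hbdd hdim hrK hG' h'))
  have h2 := hx.faceSum_cutFace_lt hr hbdd hdim (I := activeSet a b G) (J := activeSet a b G')
    (e := K - 1 - r) (by omega) (by
      rw [show K - 1 - r + 1 = K - r by omega]
      unfold faceSum at h h' ⊢
      linarith)
  rw [← inter_eq_cutFace hn hbdd hdim hG hG'] at h2
  exact absurd h1 (not_le.2 h2)

/-- If `i` is active on `F` and its slack were small, adding `i` to the constraints of `G` would
give a smaller face that still contains `F` and has too small a sum. -/
theorem NearFace.lt_slack (hx : NearFace a b r F x) (hr : r + 2 ≤ n)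
    (hbdd : Bornology.IsBounded (polyhedron a b)) (hdim : HasDim (polyhedron a b) n)
    (hrK : r < K) (hK : K + 1 ≤ n) (hfar : FarFromRanks a b r K (faceSum a b F x) x)
    (hG : G ∈ facesOfRank (polyhedron a b) K)
    (h : faceSum a b G x < 4 * m * tau a b ^ (K - r) * faceSum a b F x) {i : Fin m}
    (hi : i ∉ activeSet a b G) :
    4 * m * tau a b ^ (K - r) * faceSum a b F x ≤ slack a b i x := by
  have hn : 1 ≤ n := by omega
  have hw := hx.pos
  by_cases hiF : i ∈ activeSet a b F
  · by_contra hc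
    push Not at hc
    have hFG := hx.subset_of_faceSum_lt_pow hr hbdd hdim hrK hG h
    obtain ⟨j, hj⟩ := exists_rank_cutFace (a := a) (b := b) (activeSet a b G ∪ {i})
    have hsub : cutFace a b (activeSet a b G ∪ {i}) ⊆ G := by
      rw [cutFace_union, ← eq_cutFace hn hbdd hdim hG]
      exact Set.inter_subset_left
    have hjK : j < K := by
      refine rank_lt_of_ssubset hj hG (Set.ssubset_iff_subset_ne.2 ⟨hsub, fun e => hi ?_⟩)
      rw [← e]
      exact subset_activeSet_cutFace _ (by simp)
    have hFsub : F ⊆ cutFace a b (activeSet a b G ∪ {i}) := by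
      rw [cutFace_union, ← eq_cutFace hn hbdd hdim hG]
      exact Set.subset_inter hFG fun y hy => ⟨subset_of_mem_facesOfRank hx.rank hy, by
        simpa using mem_activeSet.1 hiF y hy⟩
    have h1 := hx.le_faceSum hr hbdd hdim hfar hjK hj hFsub
    have h2 := hx.faceSum_cutFace_lt hr hbdd hdim (I := activeSet a b G) (J := {i})
      (e := K - 1 - r) (by omega) (by
        rw [show K - 1 - r + 1 = K - r by omega, Finset.sum_singleton]
        unfold faceSum at h hc ⊢
        linarith)
    exact absurd h1 (not_le.2 h2)
  · refine le_trans ?_ (hx.le_slack i hiF)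
    have h1 := four_mul_tau_pow_le hn hbdd hdim (by omega : 1 ≤ K - r)
    have h2 := mul_tau_le hn hbdd hdim
    exact mul_le_of_le_one_left hw.le (by linarith)

/-- If a point near a face is even closer to a larger face, at which the polynomials of that face
are nonnegative, then it is near that face as well. -/
theorem NearFace.step (hx : NearFace a b r F x) (hr : r + 2 ≤ n)
    (hbdd : Bornology.IsBounded (polyhedron a b)) (hdim : HasDim (polyhedron a b) n)
    (hrK : r < K) (hK : K + 2 ≤ n) (hfar : FarFromRanks a b r K (faceSum a b F x) x)
    (hG : G ∈ facesOfRank (polyhedron a b) K)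
    (h : faceSum a b G x < 4 * m * tau a b ^ (K - r) * faceSum a b F x)
    (hlin : 0 ≤ faceSum a b G x)
    (hpow : 0 ≤ eval x (powPoly a b (delta a b K) (expo a b K) G)) :
    x ∈ polyhedron a b ∨ NearFace a b K G x := by
  have hn : 1 ≤ n := by omega
  have hδ := delta_pos hn hbdd hdim K
  have hout : ∀ i ∉ activeSet a b G, faceSum a b G x < slack a b i x := fun i hi =>
    h.trans_le (hx.lt_slack hr hbdd hdim hrK (by omega) hfar hG h hi)
  have hin := fun i (hi : i ∈ activeSet a b G) =>
    abs_le_of_powPoly_nonneg hδ (delta_le_one hn hbdd hdim K) (Nat.le_ceil _) hpow hi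
  rw [abs_of_nonneg hlin] at hin
  have hlow : ∀ i, -(delta a b K * faceSum a b G x) ≤ slack a b i x := by
    intro i
    by_cases hi : i ∈ activeSet a b G
    · have := (abs_le.1 (hin i hi)).1
      linarith
    · nlinarith [hout i hi]
  rcases hlin.eq_or_lt with h0 | h0
  · refine Or.inl (mem_polyhedron_iff.2 fun i => ?_)
    simpa [← h0] using hlow i
  · exact Or.inr ⟨hG, h0, hlow, fun i hi => (hout i hi).le⟩

/-- The threshold `4mτ^(K-r)` is made for this: `δ_r = δ_K/(4m) · 4mτ^(K-r)`, so the violation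
allowed near `F` is the one that `powPoly_pos` tolerates for `G`. -/
theorem NearFace.powPoly_pos (hx : NearFace a b r F x)
    (hbdd : Bornology.IsBounded (polyhedron a b)) (hdim : HasDim (polyhedron a b) n)
    (hrK : r < K) (hK : K + 2 ≤ n)
    (h : 4 * m * tau a b ^ (K - r) * faceSum a b F x ≤ faceSum a b G x) :
    0 < eval x (powPoly a b (delta a b K) (expo a b K) G) := by
  have hn : 1 ≤ n := by omega
  have hτ := tau_pos hn hbdd hdim
  have hm := pos_of_hasDim hn hbdd hdim
  have hw := hx.pos
  refine _root_.powPoly_pos (delta_pos hn hbdd hdim K) (expo_ne_zero hn hbdd hdim K) hm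
    (lt_of_lt_of_le (by positivity) h) fun i _ => le_trans (neg_le_neg ?_) (hx.lower i)
  have h1 : delta a b r = delta a b K / (4 * m) * (4 * m * tau a b ^ (K - r)) := by
    unfold delta
    rw [show n - 1 - r = (n - 1 - K) + (K - r) by omega, pow_add]
    field_simp
  have h2 : 0 ≤ delta a b K / (4 * m) := by
    have := delta_pos hn hbdd hdim K
    positivity
  rw [h1, mul_assoc]
  exact mul_le_mul_of_nonneg_left h h2

theorem NearFace.mem_of_farFromRanks (hx : NearFace a b r F x) (hr : r + 2 ≤ n)
    (hbdd : Bornology.IsBounded (polyhedron a b)) (hdim : HasDim (polyhedron a b) n)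
    (hfar : FarFromRanks a b r (n - 1) (faceSum a b F x) x)
    (hlin : ∀ k, 1 ≤ k → k ≤ n → 0 ≤ eval x (linProduct a b k)) : x ∈ polyhedron a b := by
  have hn : 1 ≤ n := by omega
  have hτ := tau_pos hn hbdd hdim
  have hm := pos_of_hasDim hn hbdd hdim
  have hw := hx.pos
  simp only [eval_linProduct] at hlin
  by_contra hxP
  obtain ⟨H, hH, hHx⟩ := exists_facet_faceSum_neg hn hbdd hdim hxP
  obtain ⟨H', hH', hne, hHx'⟩ :=
    exists_ne_nonpos_of_prod_nonneg (hlin n hn le_rfl) (by simpa using hH) hHx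
  rw [Set.Finite.mem_toFinset] at hH'
  have hpos : 0 < 4 * m * tau a b * faceSum a b F x := by positivity
  obtain ⟨j, hj, hHH'⟩ := exists_rank_inter hn hbdd hdim hH hH' hne.symm
  have h1 := hx.faceSum_cutFace_lt hr hbdd hdim (I := activeSet a b H) (J := activeSet a b H')
    (e := n - 1 - 1 - r) (by omega) (by
      have : 0 ≤ 8 * m * tau a b ^ (n - 1 - 1 - r + 1) * faceSum a b F x := by positivity
      unfold faceSum at this hHx hHx' ⊢
      linarith)
  rw [← inter_eq_cutFace hn hbdd hdim hH hH'] at h1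
  -- The meet contains `F` and has a small sum, so `hfar` excludes every rank below that of a ridge.
  have hj1 : j = n - 1 := by
    by_contra hc
    exact absurd (hx.le_faceSum hr hbdd hdim hfar (by omega) hHH' (Set.subset_inter
      (hx.subset_of_faceSum_lt hr hbdd hdim hH (hHx.trans hpos))
      (hx.subset_of_faceSum_lt hr hbdd hdim hH' (hHx'.trans_lt hpos)))) (not_le.2 h1)
  subst hj1
  have hneg := faceSum_ridge_neg (by omega) hbdd hdim hH hH' hne.symm hHH' hHx hHx'
  obtain ⟨G, hG, hGne, hGx⟩ := exists_ne_nonpos_of_prod_nonneg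
    (hlin (n - 1) (by omega) (by omega)) (by simpa using hHH') hneg
  rw [Set.Finite.mem_toFinset] at hG
  have hpos' : 0 < 4 * m * tau a b ^ (n - 1 - r) * faceSum a b F x := by positivity
  exact hGne (hx.eq_of_faceSum_lt hr hbdd hdim (by omega) (by omega) hfar hG hHH'
    (hGx.trans_lt hpos') (hneg.trans hpos'))

theorem NearFace.mem_polyhedron (hx : NearFace a b r F x) (hr : r + 2 ≤ n)
    (hbdd : Bornology.IsBounded (polyhedron a b)) (hdim : HasDim (polyhedron a b) n)
    (hlin : ∀ k, 1 ≤ k → k ≤ n → 0 ≤ eval x (linProduct a b k))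
    (hpow : ∀ k, k + 2 ≤ n → 0 ≤ eval x (powProduct a b k)) : x ∈ polyhedron a b := by
  classical
  induction hN : n - r using Nat.strong_induction_on generalizing r F with
  | _ N ih =>
  have hn : 1 ≤ n := by omega
  have hτ := tau_pos hn hbdd hdim
  have hm := pos_of_hasDim hn hbdd hdim
  have hw := hx.pos
  by_cases hbad : ∃ K, r < K ∧ K + 2 ≤ n ∧ ∃ G ∈ facesOfRank (polyhedron a b) K,
      faceSum a b G x < 4 * m * tau a b ^ (K - r) * faceSum a b F x
  · have hmin := fun k => Nat.find_min hbad (m := k)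
    obtain ⟨hrK, hK, G, hG, hGx⟩ := Nat.find_spec hbad
    set K := Nat.find hbad
    have hfar : FarFromRanks a b r K (faceSum a b F x) x := by
      intro k hrk hkK G' hG'
      by_contra hc
      exact hmin k hkK ⟨hrk, by omega, G', hG', not_le.1 hc⟩
    have hunique : ∀ G' ∈ facesOfRank (polyhedron a b) K, G' ≠ G →
        4 * m * tau a b ^ (K - r) * faceSum a b F x ≤ faceSum a b G' x := by
      intro G' hG' hne
      by_contra hc
      exact hne (hx.eq_of_faceSum_lt hr hbdd hdim hrK (by omega) hfar hG' hG (not_le.1 hc) hGx)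
    have hl : 0 ≤ faceSum a b G x := by
      by_contra hc
      have h1 := hlin K (by omega) (by omega)
      rw [eval_linProduct] at h1
      obtain ⟨G', hG', hne, hG'x⟩ :=
        exists_ne_nonpos_of_prod_nonneg h1 (by simpa using hG) (not_le.1 hc)
      rw [Set.Finite.mem_toFinset] at hG'
      have h2 := hunique G' hG' hne
      have h3 : 0 < 4 * m * tau a b ^ (K - r) * faceSum a b F x := by positivity
      linarith
    have hp : 0 ≤ eval x (powPoly a b (delta a b K) (expo a b K) G) := by
      by_contra hc
      have h1 := hpow K hK
      rw [eval_powProduct] at h1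
      obtain ⟨G', hG', hne, hG'x⟩ :=
        exists_ne_nonpos_of_prod_nonneg h1 (by simpa using hG) (not_le.1 hc)
      rw [Set.Finite.mem_toFinset] at hG'
      exact absurd (hx.powPoly_pos hbdd hdim hrK hK (hunique G' hG' hne)) (not_lt.2 hG'x)
    rcases hx.step hr hbdd hdim hrK hK hfar hG hGx hl hp with h | h
    · exact h
    · exact ih (n - K) (by omega) h hK rfl
  · push Not at hbad
    exact hx.mem_of_farFromRanks hr hbdd hdim
      (fun k hrk hk G hG => hbad k hrk (by omega) G hG) hlin

theorem nearFace_empty (hn : 2 ≤ n) (hbdd : Bornology.IsBounded (polyhedron a b))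
    (hdim : HasDim (polyhedron a b) n)
    (hpow : 0 ≤ eval x (powPoly a b (delta a b 0) (expo a b 0) ∅)) :
    NearFace a b 0 ∅ x := by
  have hn' : 1 ≤ n := by omega
  obtain ⟨hs, hsS⟩ := minSlack_pos_le hn' hbdd hdim
  have hm := pos_of_hasDim hn' hbdd hdim
  have hτ := tau_pos hn' hbdd hdim
  have hδ := delta_pos hn' hbdd hdim 0
  have hδτ := delta_le_tau hbdd hdim (r := 0) (by omega)
  have hτm := tau_mul hn' hbdd hdim
  have hin := fun i => abs_le_of_powPoly_nonneg (i := i) hδ (delta_le_one hn' hbdd hdim 0)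
    (Nat.le_ceil _) hpow (by simp [activeSet_empty])
  have hpos : 0 < faceSum a b ∅ x := by
    by_contra hp
    push Not at hp
    rw [abs_of_nonpos hp] at hin
    obtain ⟨q, hqP, hq⟩ := exists_center hbdd hdim hm
    have hm1 : (1 : ℝ) ≤ m := by exact_mod_cast hm
    set s := minSlack a b
    set S := maxSlack a b
    set δ := delta a b 0
    have hS : 0 < S := hs.trans_le hsS
    obtain ⟨w, hw⟩ : ∃ w, w = - faceSum a b ∅ x := ⟨_, rfl⟩
    have hw0 : 0 ≤ w := by linarith
    -- If the total slack is `-w ≤ 0`, no slack exceeds `δw`, so moving from the centre `q` away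
    -- from `x` stays in `P` for long.
    have hu : ∀ i, slack a b i x ≤ δ * w := fun i => by
      have := (abs_le.1 (hin i)).2
      rw [hw]
      linarith
    have hqpos : 0 < faceSum a b ∅ q :=
      faceSum_pos hn' hbdd hdim (k := 0) rfl hqP (Set.notMem_empty q)
    have hray : ∀ t : ℝ, 0 ≤ t → t * (δ * w - s / m) ≤ s / m →
        q + t • (q - x) ∈ polyhedron a b := by
      intro t ht h
      refine mem_polyhedron_iff.2 fun i => ?_
      have e : slack a b i (q + t • (q - x)) =
          slack a b i q + t * (slack a b i q - slack a b i x) := by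
        simp only [slack, dotProduct_add, dotProduct_smul, dotProduct_sub, smul_eq_mul]
        ring
      rw [e]
      rcases hq i with h0 | h0
      · simp [h0]
      · have h1 := mul_le_mul_of_nonneg_left (hu i) ht
        have h2 := mul_le_mul_of_nonneg_left h0 ht
        linarith
    rcases le_or_gt (δ * w) (s / m) with h | h
    · have hqx := eq_zero_of_ray_subset hbdd (x := q) (v := q - x) fun t ht =>
        hray t ht (le_trans (by nlinarith) (by positivity : (0 : ℝ) ≤ s / m))
      rw [sub_eq_zero.1 hqx] at hqpos
      linarith
    · have hd : 0 < δ * w - s / m := by linarith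
      -- The largest `t` that `hray` allows. The total slack there is at least `tw` and at most
      -- `mS`, which forces `s/m < mSδ`, too small for `δ ≤ τ`.
      obtain ⟨t, ht⟩ : ∃ t, t = s / m / (δ * w - s / m) := ⟨_, rfl⟩
      have ht0 : 0 ≤ t := by rw [ht]; positivity
      have htd : t * (δ * w - s / m) = s / m := by
        rw [ht, div_mul_cancel₀ _ hd.ne']
      have h1 := faceSum_le hbdd ∅ (hray t ht0 htd.le)
      have e : faceSum a b ∅ (q + t • (q - x)) =
          (1 + t) * faceSum a b ∅ q + (-t) * faceSum a b ∅ x := by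
        rw [← faceSum_comb _ (by ring)]
        congr 1
        module
      rw [e] at h1
      have h2 : t * w ≤ m * S := by
        rw [hw]
        nlinarith [mul_nonneg ht0 hqpos.le]
      have hw1 : 0 < w := by
        refine lt_of_le_of_ne hw0 fun h0 => ?_
        rw [← h0, mul_zero] at h
        have : 0 < s / m := by positivity
        linarith
      have ht1 : 0 < t := by rw [ht]; positivity
      have h3 : s / m < m * S * δ := by
        have h4 : t * (δ * w - s / m) < t * w * δ := by
          have : 0 < t * (s / m) := by positivity
          linarith
        have h5 := mul_le_mul_of_nonneg_right h2 hδ.le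
        linarith
      rw [div_lt_iff₀ (by positivity)] at h3
      have h6 : s * s < s ^ 2 / 32 := by
        calc s * s ≤ s * S := by gcongr
          _ < m * S * δ * m * S := by gcongr
          _ ≤ m * S * tau a b * m * S := by gcongr
          _ ≤ m * S * tau a b * m * S * m := le_mul_of_one_le_right (by positivity) hm1
          _ = s ^ 2 / 32 := by rw [← hτm]; ring
      nlinarith
  rw [abs_of_pos hpos] at hin
  refine ⟨rfl, hpos, fun i => ?_, fun i hi => absurd (by simp [activeSet_empty]) hi⟩
  have := (abs_le.1 (hin i)).1
  linarith

end Chain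

theorem theorem1p2 {n m : ℕ} (hn : 1 ≤ n) (a : Fin m → Fin n → ℝ) (b : Fin m → ℝ)
    (hbdd : Bornology.IsBounded (polyhedron a b)) (hdim : HasDim (polyhedron a b) n) :
    polyhedron a b = basicClosed (polytopePolys a b) := by
  refine Set.Subset.antisymm (fun x hx j => ?_) fun x hx => ?_
  · unfold polytopePolys
    split_ifs
    · rw [eval_linProduct]
      exact Finset.prod_nonneg fun F _ => faceSum_nonneg F hx
    · rw [eval_powProduct]
      exact Finset.prod_nonneg fun F _ =>
        powPoly_nonneg (delta_pos hn hbdd hdim _).le _ F hx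
  · have hlin : ∀ k, 1 ≤ k → k ≤ n → 0 ≤ eval x (linProduct a b k) := by
      intro k hk1 hk
      have h := hx ⟨k - 1, by omega⟩
      simp only [polytopePolys, if_pos (by omega : k - 1 < n), Nat.sub_add_cancel hk1] at h
      exact h
    have hpow : ∀ k, k + 2 ≤ n → 0 ≤ eval x (powProduct a b k) := by
      intro k hk
      have h := hx ⟨n + k, by omega⟩
      simp only [polytopePolys, if_neg (by omega : ¬ n + k < n), Nat.add_sub_cancel_left] at h
      exact h
    rcases hn.eq_or_lt with rfl | hn2
    · by_contra hxP
      obtain ⟨H, hH, hHx⟩ := exists_facet_faceSum_neg le_rfl hbdd hdim hxP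
      have h := hlin 1 le_rfl le_rfl
      rw [eval_linProduct] at h
      obtain ⟨H', hH', hne, hHx'⟩ :=
        exists_ne_nonpos_of_prod_nonneg h (by simpa using hH) hHx
      rw [Set.Finite.mem_toFinset] at hH'
      exact absurd hHx' (not_le.2 (faceSum_facet_pos_of_dim_one hbdd hdim hH hH' hne.symm hHx))
    · have h0 := hpow 0 (by omega)
      -- The product of rank 0 has a single factor, so its sign is that of the polynomial of the
      -- empty face.
      have hfin : (facesOfRank_polyhedron_finite a b 0).toFinset = {∅} := by
        ext F
        simp [facesOfRank]
      rw [eval_powProduct, hfin, Finset.prod_singleton] at h0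
      exact (nearFace_empty hn2 hbdd hdim h0).mem_polyhedron (by omega) hbdd hdim hlin hpow
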